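/- Let $X$ be a Banach space, $r>0$, $a\in\mathbb R$, and let $C=C([-r,0];X)$ carry the supremum norm. For a continuous $u:[a-r,b)\to X$ and $t\in[a,b)$ let $u_t\in C$, $u_t(\theta)=u(t+\theta)$. Let $T(t)=e^{-At}$, $t\ge 0$, be a $C_0$-semigroup on $X$ with $\|T(t)\|\le e^{\omega t}$ for all $t\ge0$, for some $\omega\in\mathbb R$. Consider $$u'(t)+Au(t)=B(t,u_t),\quad t\ge a,\qquad u_a=\varphi\in C,$$ where $$B(t,\psi)=G\big(t,\psi(0),F(t,\psi)\big),\qquad F(t,\psi)=\int_{-r}^0p(t,\psi(\theta))\,dg(\theta,t,\psi)$$ (a Lebesgue–Stieltjes integral over $[-r,0]$, including the jumps of $g$ at the endpoints). A mild solution on $[a-r,\tau]$ is a $u\in C([a-r,\tau];X)$ with $u_a=\varphi$ and $u(t)=T(t-a)\varphi(0)+\int_a^tT(t-s)B(s,u_s)\,ds$ for $t\in[a,\tau]$; a mild solution on $[a,b)$ is a function on $[a-r,b)$ whose restriction to $[a-r,\tau]$ is a mild solution for each $\tau\in[a,b)$. Assume: (A1) For all $(t,\varphi)\in\mathbb R\times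 C$ the function $g(\cdot,t,\varphi):[-r,0]\to\mathbb R$ is of bounded variation, with total variation at most a constant $M$ independent of $(t,\varphi)$. Write $g=g_d+g_c$, where, as functions of $\theta$, $g_d$ is a step function (possibly with countably many jumps) and $g_c$ is continuous. (A2) For each $\theta\in[-r,0]$ the map $(t,\varphi)\mapsto g_c(\theta,t,\varphi)$ is continuous on $\mathbb R\times C$. (A3) There are continuous functions $\eta_k:\mathbb R\times C\to[0,r]$ and $h_k:\mathbb R\times C\to\mathbb R$, $k\in\mathbb N$, such that the discontinuities of $g_d(\cdot,t,\varphi)$ lie at the points $-\eta_k(t,\varphi)$, with jumps $h_k(t,\varphi)$ (if several $\eta_k(t,\varphi)$ coincide, the jump at that point is the sum of the corresponding $h_k(t,\varphi)$), and the series $\sum_k|h_k(t,\varphi)|$ converges uniformly on bounded subsets of $\mathbb R\times C$. (A4) There is $L\ge0$ such that for all $t^1,t^2\ge a$ and $\varphi,\psi\in C$ the total variation on $[-r,0]$ of $g_c(\cdot,t^1,\varphi)-g_c(\cdot,t^2,\psi)$ is at most $L(|t^1-t^2|+\|\varphi-\psi\|_C)$. (A5) There is a continuous function $\eta_{ign}:[a,\infty)\to(0,\infty)$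 such that for all $t\ge a$ and $\varphi^1,\varphi^2\in C$ with $\varphi^1(\theta)=\varphi^2(\theta)$ for all $\theta\in[-r,-\eta_{ign}(t)]$ one has $\eta_k(t,\varphi^1)=\eta_k(t,\varphi^2)$ and $h_k(t,\varphi^1)=h_k(t,\varphi^2)$ for all $k$. Assume also that $p:\mathbb R\times X\to X$ satisfies $\|p(t,u)-p(s,v)\|\le L_p(|t-s|+\|u-v\|)$ and $\|p(s,u)\|\le C_1\|u\|+C_2$ with constants $L_p$ and $C_1,C_2\ge0$, and that $G:\mathbb R\times X\times X\to X$ is continuous and for each $R>0$ there is $L_{G,R}>0$ with $$\|G(t,u^1,v^1)-G(t,u^2,v^2)\|\le L_{G,R}\big(\|u^1-u^2\|+\|v^1-v^2\|\big)\quad\text{for all }t>a,\ \|u^i\|,\|v^i\|\le R.$$ Then for every $\varphi\in C$ the problem has a unique mild solution $u$ on a maximal interval $[a,b)$, $a<b\le+\infty$: any mild solution on any $[a-r,\tau]$, $\tau\ge a$, with the same initial function satisfies $\tau<b$ and coincides with $u$ on $[a-r,\tau]$. The solution is continuous with respect to the initial data: if $\|\varphi^n-\varphi\|_C\to0$ and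 $u^n$, on $[a,b_n)$, is the unique maximal mild solution with initial function $\varphi^n$, then for each $t\in[a,b)$ one has $t<b_n$ for all large $n$, and $\|u^n_t-u_t\|_C\to0$. -/

import Mathlib

open Set Filter Topology MeasureTheory

/-- Closed subintervals of a compact interval are compact. -/
instance compactIccSpace_subtype (c d : ℝ) : CompactIccSpace (Icc c d) where
  isCompact_Icc {_ _} := isClosed_Icc.isCompact

/-- The phase space of continuous functions from `[-r, 0]` to `X`, with the supremum norm. -/
abbrev HistorySpace (r : ℝ) (X : Type*) [NormedAddCommGroup X] : Type _ :=
  C(Icc (-r) (0 : ℝ), X)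

/-- The right endpoint `0` of `[-r, 0]`. -/
def zeroPt {r : ℝ} (hr : 0 < r) : Icc (-r) (0 : ℝ) :=
  ⟨0, neg_nonpos.2 hr.le, le_rfl⟩

open scoped Classical in
/-- The history `u_t`, given by `u_t(θ) = u(t + θ)` for `θ ∈ [-r, 0]`. It is only used for `u`
continuous on `[t - r, t]`; the value `0` otherwise is a placeholder. -/
noncomputable def history {X : Type*} [NormedAddCommGroup X] (r : ℝ) (u : ℝ → X) (t : ℝ) :
    HistorySpace r X :=
  if hu : Continuous (fun θ : Icc (-r) (0 : ℝ) => u (t + θ)) then ⟨_, hu⟩ else 0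

/-- A `C₀`-semigroup `T(t)`, `t ≥ 0`, of bounded linear operators on `X`
(the values at negative times are irrelevant). -/
structure IsC0Semigroup {X : Type*} [NormedAddCommGroup X] [NormedSpace ℝ X]
    (T : ℝ → X →L[ℝ] X) : Prop where
  map_zero : T 0 = ContinuousLinearMap.id ℝ X
  map_add : ∀ s t : ℝ, 0 ≤ s → 0 ≤ t → T (s + t) = (T s).comp (T t)
  tendsto_zero : ∀ x : X, Tendsto (fun t => T t x) (𝓝[≥] 0) (𝓝 x)

open scoped Classical in
/-- The Lebesgue–Stieltjes integral `∫_{-r}^0 f(θ) dg(θ)` of a vector valued function with respect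
to a real function of bounded variation: the integral against the signed measure `dg` on `[-r, 0]`,
for which `{θ}` has mass `g(θ+0) - g(θ-0)`, with `g(0+0) = g(0)` and `g(-r-0) = g(-r)`. -/
noncomputable def stieltjesIntegral {X : Type*} [NormedAddCommGroup X] [NormedSpace ℝ X]
    {r : ℝ} (f : Icc (-r) (0 : ℝ) → X) (g : Icc (-r) (0 : ℝ) → ℝ) : X :=
  if hg : BoundedVariationOn g univ then
    hg.vectorMeasure.integral f (ContinuousLinearMap.lsmul ℝ ℝ).flip
  else 0

/-- The jump `f(θ+0) - f(θ-0)`, where `f(0+0) = f(0)` and `f(-r-0) = f(-r)` at the endpoints. -/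
noncomputable def jump {r : ℝ} (f : Icc (-r) (0 : ℝ) → ℝ) (θ : Icc (-r) (0 : ℝ)) : ℝ :=
  Function.rightLim f θ - Function.leftLim f θ

/-- A step function (possibly with countably many jumps): a function of bounded variation whose
increments `f(θ₂+0) - f(θ₁-0)` are the sums of its jumps at the points of `[θ₁, θ₂]`. -/
def IsStepFunction {r : ℝ} (f : Icc (-r) (0 : ℝ) → ℝ) : Prop :=
  BoundedVariationOn f univ ∧
    ∀ θ₁ θ₂ : Icc (-r) (0 : ℝ), θ₁ ≤ θ₂ →
      HasSum (fun s : Icc θ₁ θ₂ => jump f s) (Function.rightLim f θ₂ - Function.leftLim f θ₁)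

section Assumptions

variable {X : Type*} [NormedAddCommGroup X] {r : ℝ}

/-- The functions `g(·, t, φ)` are of bounded variation on `[-r, 0]`, with a common bound. -/
def HasUniformlyBoundedVariation (g : Icc (-r) (0 : ℝ) → ℝ → HistorySpace r X → ℝ) : Prop :=
  ∃ M : ℝ, 0 < M ∧ ∀ (t : ℝ) (φ : HistorySpace r X),
    eVariationOn (fun θ => g θ t φ) univ ≤ ENNReal.ofReal M

/-- `g = g_d + g_c` is a splitting into a step function and a continuous function of the first
variable. -/
def IsSplitting (g gd gc : Icc (-r) (0 : ℝ) → ℝ → HistorySpace r X → ℝ) : Prop :=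
  ∀ (t : ℝ) (φ : HistorySpace r X),
    IsStepFunction (fun θ => gd θ t φ) ∧ Continuous (fun θ => gc θ t φ) ∧
      ∀ θ, g θ t φ = gd θ t φ + gc θ t φ

/-- For each `θ` the function `g_c(θ, t, φ)` is continuous in `(t, φ)`. -/
def IsPointwiseContinuous (gc : Icc (-r) (0 : ℝ) → ℝ → HistorySpace r X → ℝ) : Prop :=
  ∀ θ, Continuous (fun x : ℝ × HistorySpace r X => gc θ x.1 x.2)

open scoped Classical in
/-- The discontinuities of `g_d(·, t, φ)` are located at the points `-η_k(t, φ)`, with jumps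
`h_k(t, φ)`, where `η_k` and `h_k` are continuous, and `∑ h_k` converges absolutely and uniformly on
bounded sets. Delays `η_k` that coincide at some `(t, φ)` contribute the sum of their `h_k`; fewer
delays are allowed, by taking some `h_k = 0`. -/
structure HasContinuousJumps (gd : Icc (-r) (0 : ℝ) → ℝ → HistorySpace r X → ℝ)
    (η h : ℕ → ℝ → HistorySpace r X → ℝ) : Prop where
  delay_mem : ∀ k t φ, η k t φ ∈ Icc 0 r
  delay_continuous : ∀ k, Continuous (fun x : ℝ × HistorySpace r X => η k x.1 x.2)
  jump_continuous : ∀ k, Continuous (fun x : ℝ × HistorySpace r X => h k x.1 x.2)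
  summable_jump : ∀ t φ, Summable (fun k => |h k t φ|)
  uniform_jump : ∀ S : Set (ℝ × HistorySpace r X), Bornology.IsBounded S →
    TendstoUniformlyOn (fun (n : ℕ) (x : ℝ × HistorySpace r X) =>
        ∑ k ∈ Finset.range n, |h k x.1 x.2|)
      (fun x => ∑' k, |h k x.1 x.2|) atTop S
  jump_eq : ∀ t φ θ, jump (fun s => gd s t φ) θ =
    ∑' k, if (θ : ℝ) = -η k t φ then h k t φ else 0

/-- On `[a, ∞)`, the function `g_c` is Lipschitz in `(t, φ)` with respect to total variation. -/
def IsLipschitzInVariation (a : ℝ) (gc : Icc (-r) (0 : ℝ) → ℝ → HistorySpace r X → ℝ) : Prop :=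
  ∃ L : ℝ, 0 ≤ L ∧ ∀ t₁ t₂ : ℝ, a ≤ t₁ → a ≤ t₂ → ∀ φ ψ : HistorySpace r X,
    eVariationOn (fun θ => gc θ t₁ φ - gc θ t₂ ψ) univ ≤
      ENNReal.ofReal (L * (|t₁ - t₂| + ‖φ - ψ‖))

/-- All `η_k(t, ·)` and `h_k(t, ·)`, `t ≥ a`, ignore the values of `φ` on `(-η_ign(t), 0]`, for some
continuous positive function `η_ign`. -/
def IgnoresRecentHistory (a : ℝ) (η h : ℕ → ℝ → HistorySpace r X → ℝ) : Prop :=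
  ∃ ηign : ℝ → ℝ, ContinuousOn ηign (Ici a) ∧ (∀ t, a ≤ t → 0 < ηign t) ∧
    ∀ t, a ≤ t → ∀ φ₁ φ₂ : HistorySpace r X,
      (∀ θ : Icc (-r) (0 : ℝ), (θ : ℝ) ≤ -ηign t → φ₁ θ = φ₂ θ) →
        ∀ k, η k t φ₁ = η k t φ₂ ∧ h k t φ₁ = h k t φ₂

variable [NormedSpace ℝ X]

/-- The delay functional `F(t, ψ) = ∫_{-r}^0 p(t, ψ(θ)) dg(θ, t, ψ)`. -/
noncomputable def delayFunctional (p : ℝ → X → X)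
    (g : Icc (-r) (0 : ℝ) → ℝ → HistorySpace r X → ℝ) (t : ℝ) (ψ : HistorySpace r X) : X :=
  stieltjesIntegral (fun θ => p t (ψ θ)) (fun θ => g θ t ψ)

/-- The delay term `B(t, ψ) = G(t, ψ(0), F(t, ψ))`. -/
noncomputable def delayTerm (hr : 0 < r) (G : ℝ → X → X → X) (p : ℝ → X → X)
    (g : Icc (-r) (0 : ℝ) → ℝ → HistorySpace r X → ℝ) (t : ℝ) (ψ : HistorySpace r X) : X :=
  G t (ψ (zeroPt hr)) (delayFunctional p g t ψ)

/-- `u` is a mild solution on `[a - r, τ]` of `u'(t) + A u(t) = B(t, u_t)`, `t ≥ a`, `u_a = φ`,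
where `T(t) = e^{-At}`. -/
structure IsMildSolutionOn (hr : 0 < r) (T : ℝ → X →L[ℝ] X) (B : ℝ → HistorySpace r X → X)
    (a : ℝ) (φ : HistorySpace r X) (τ : ℝ) (u : ℝ → X) : Prop where
  continuousOn : ContinuousOn u (Icc (a - r) τ)
  initial : ∀ θ : Icc (-r) (0 : ℝ), u (a + θ) = φ θ
  integrable : ∀ t ∈ Icc a τ,
    IntervalIntegrable (fun s => T (t - s) (B s (history r u s))) volume a t
  eq_integral : ∀ t ∈ Icc a τ,
    u t = T (t - a) (φ (zeroPt hr)) + ∫ s in a..t, T (t - s) (B s (history r u s))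

/-- `u` is the unique mild solution on the maximal interval `[a, b)`, `a < b ≤ ∞`: it is a mild
solution on `[a - r, τ]` for each `τ < b`, and any mild solution on any `[a - r, τ]`, `τ ≥ a`,
satisfies `τ < b` and agrees with `u` on `[a - r, τ]`. -/
structure IsMaximalMildSolution (hr : 0 < r) (T : ℝ → X →L[ℝ] X) (B : ℝ → HistorySpace r X → X)
    (a : ℝ) (φ : HistorySpace r X) (b : EReal) (u : ℝ → X) : Prop where
  lt : (a : EReal) < b
  isMildSolutionOn : ∀ τ : ℝ, a ≤ τ → (τ : EReal) < b → IsMildSolutionOn hr T B a φ τ u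
  unique : ∀ (τ : ℝ) (v : ℝ → X), a ≤ τ → IsMildSolutionOn hr T B a φ τ v →
    (τ : EReal) < b ∧ EqOn v u (Icc (a - r) τ)

end Assumptions

/-!
# Well-posedness for an equation with state-dependent delays

The difficulty is that `B(t, ·)` is in general not Lipschitz, because the delays `η_k` and the
jumps `h_k` are merely continuous in the history. They ignore the most recent part of the history,
though. So if two histories at time `t` have a common past up to a time `s` with
`t - s < η_ign(t)`, then they have the same delays and jumps. On such pairs the discrete part
`∑ h_k p(t, φ(-η_k))` of the delay functional is Lipschitz, since `p` is and `∑ |h_k|` is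
locally bounded. The part generated by `g_c` is locally Lipschitz without restriction, by the bound
`|∫ f dg| ≤ sup |f| * Var g` for continuous `g`. Hence `B` is continuous (for `t ≥ a`) and satisfies
`LipschitzForCommonPast` (`lipschitzForCommonPast_delayTerm`). The rest of the argument uses these
two properties only.

A mild solution that starts at time `s` has a prescribed past, and so all competing functions have a
common past up to `s`. The contraction principle applies on short intervals and gives existence, on
an interval whose length is uniform in the initial data near a given point
(`exists_isMildSolutionOn_of_small`, `exists_uniform_local_isMildSolutionOn`). Comparison of two
solutions (`IsMildSolutionOn.norm_sub_le`) gives uniqueness, and the maximal solution is obtained by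
gluing.

For continuous dependence the solutions `uₙ` and `u` have different pasts. On `[s, τ]` the solution
`uₙ` is therefore compared with the function that has the past of `uₙ` and the increments of `u`.
It has a common past with `uₙ`, so the Lipschitz estimate applies to this pair, and it is uniformly
close to `u`, so that the continuity of `B` on the compact trajectory of `u` handles the other
difference. Uniformity of the local existence time then propagates convergence along `[a, b)`.
-/

/-! ### Stieltjes integrals on `[-r, 0]` -/

section Stieltjes

open VectorMeasure
open scoped ENNReal NNReal

variable {r : ℝ}

/-- A finite signed measure on `[-r, 0]` is determined by its values on closed intervals, where the
Stieltjes measure `dg` is given by the one-sided limits of `g`. -/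
theorem signedMeasure_ext_Icc {μ ν : SignedMeasure (Icc (-r) (0 : ℝ))}
    (h : ∀ a b, a ≤ b → μ (Icc a b) = ν (Icc a b)) : μ = ν := by
  refine VectorMeasure.ext_of_generateFrom
    {S | ∃ l u : Icc (-r) (0 : ℝ), l ≤ u ∧ Icc l u = S} ?_ ?_ (isPiSystem_Icc id id) ?_
  · rintro s ⟨a, b, hab, rfl⟩
    exact h a b hab
  · rw [← borel_eq_generateFrom_Icc]
    exact BorelSpace.measurable_eq
  · rcases isEmpty_or_nonempty (Icc (-r) (0 : ℝ)) with hα | ⟨⟨x, hx⟩⟩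
    · simp [univ_eq_empty_iff.2 hα]
    · have h0 : -r ≤ 0 := hx.1.trans hx.2
      have : (univ : Set (Icc (-r) (0 : ℝ))) = Icc ⟨-r, le_rfl, h0⟩ ⟨0, h0, le_rfl⟩ := by
        ext y
        simpa using ⟨y.2.1, y.2.2⟩
      rw [this]
      exact h _ _ h0

theorem eVariationOn_fun_add_le {α : Type*} [LinearOrder α] (f g : α → ℝ) (s : Set α) :
    eVariationOn (fun x => f x + g x) s ≤ eVariationOn f s + eVariationOn g s := by
  refine iSup_le fun p => ?_
  calc _ ≤ ∑ i ∈ Finset.range p.1, (edist (f (p.2.1 (i + 1))) (f (p.2.1 i)) +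
            edist (g (p.2.1 (i + 1))) (g (p.2.1 i))) :=
        Finset.sum_le_sum fun i _ => edist_add_add_le _ _ _ _
    _ ≤ _ := by
        rw [Finset.sum_add_distrib]
        exact add_le_add (le_iSup_of_le p le_rfl) (le_iSup_of_le p le_rfl)

theorem BoundedVariationOn.fun_add {α : Type*} [LinearOrder α] {f g : α → ℝ} {s : Set α}
    (hf : BoundedVariationOn f s) (hg : BoundedVariationOn g s) :
    BoundedVariationOn (fun x => f x + g x) s :=
  ne_top_of_le_ne_top (ENNReal.add_ne_top.2 ⟨hf, hg⟩) (eVariationOn_fun_add_le f g s)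

theorem BoundedVariationOn.fun_neg {α : Type*} [LinearOrder α] {f : α → ℝ} {s : Set α}
    (hf : BoundedVariationOn f s) : BoundedVariationOn (fun x => -f x) s := by
  have : eVariationOn (fun x => -f x) s = eVariationOn f s := by
    simp [eVariationOn]
  rwa [BoundedVariationOn, this]

theorem BoundedVariationOn.rightLim_add {f g : Icc (-r) (0 : ℝ) → ℝ}
    (hf : BoundedVariationOn f univ) (hg : BoundedVariationOn g univ) (x : Icc (-r) (0 : ℝ)) :
    Function.rightLim (fun y => f y + g y) x = Function.rightLim f x + Function.rightLim g x := by
  rcases eq_or_neBot (𝓝[>] x) with h | h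
  · simp only [rightLim_eq_of_eq_bot _ h]
  · exact rightLim_eq_of_tendsto ((hf.tendsto_rightLim x).add (hg.tendsto_rightLim x))

theorem BoundedVariationOn.leftLim_add {f g : Icc (-r) (0 : ℝ) → ℝ}
    (hf : BoundedVariationOn f univ) (hg : BoundedVariationOn g univ) (x : Icc (-r) (0 : ℝ)) :
    Function.leftLim (fun y => f y + g y) x = Function.leftLim f x + Function.leftLim g x := by
  rcases eq_or_neBot (𝓝[<] x) with h | h
  · simp only [leftLim_eq_of_eq_bot _ h]
  · exact leftLim_eq_of_tendsto ((hf.tendsto_leftLim x).add (hg.tendsto_leftLim x))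

theorem BoundedVariationOn.vectorMeasure_add {f g : Icc (-r) (0 : ℝ) → ℝ}
    (hf : BoundedVariationOn f univ) (hg : BoundedVariationOn g univ)
    (hfg : BoundedVariationOn (fun x => f x + g x) univ) :
    hfg.vectorMeasure = hf.vectorMeasure + hg.vectorMeasure := by
  refine signedMeasure_ext_Icc fun a b hab => ?_
  rw [_root_.add_apply, hfg.vectorMeasure_Icc hab, hf.vectorMeasure_Icc hab,
    hg.vectorMeasure_Icc hab, hf.rightLim_add hg, hf.leftLim_add hg]
  ring

instance isFiniteMeasure_variation_signedMeasure {α : Type*} [MeasurableSpace α]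
    (μ : SignedMeasure α) : IsFiniteMeasure μ.variation := by
  rw [← SignedMeasure.totalVariation_eq_variation]
  infer_instance

/-- The total variation measure of `dg` is at most the Stieltjes measure of the variation of `g`,
since this holds on half-open intervals. -/
theorem BoundedVariationOn.variation_vectorMeasure_univ_le {g : Icc (-r) (0 : ℝ) → ℝ}
    (hg : BoundedVariationOn g univ) (hc : Continuous g) :
    hg.vectorMeasure.variation univ ≤ eVariationOn g univ := by
  rcases isEmpty_or_nonempty (Icc (-r) (0 : ℝ)) with hα | ⟨⟨x, hx⟩⟩
  · simp [univ_eq_empty_iff.2 hα]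
  have h0 : -r ≤ 0 := hx.1.trans hx.2
  set l : Icc (-r) (0 : ℝ) := ⟨-r, le_rfl, h0⟩ with hl
  set u : Icc (-r) (0 : ℝ) := ⟨0, h0, le_rfl⟩ with hu
  have hlim : g.rightLim = g := funext fun x => hc.continuousWithinAt.rightLim_eq
  have hlim' : g.leftLim = g := funext fun x => hc.continuousWithinAt.leftLim_eq
  set ν := (hg.stieltjesFunctionRightLim l).measure with hν
  have hνfin : IsFiniteMeasure ν :=
    StieltjesFunction.isFiniteMeasure_of_forall_abs_le (C := (eVariationOn g.rightLim univ).toReal)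
      _ fun x => variationOnFromTo.abs_le_eVariationOn hg.rightLim
  have hIoc : ∀ a b, a ≤ b → ν (Ioc a b) = eVariationOn g (Icc a b) := by
    intro a b hab
    rw [hν, StieltjesFunction.measure_Ioc]
    simp only [BoundedVariationOn.stieltjesFunctionRightLim_apply]
    rw [← variationOnFromTo.add hg.rightLim.locallyBoundedVariationOn
      (mem_univ l) (mem_univ a) (mem_univ b), add_sub_cancel_left, hlim]
    simp only [variationOnFromTo, hab, ↓reduceIte, univ_inter]
    exact ENNReal.ofReal_toReal ((eVariationOn.mono _ (subset_univ _)).trans_lt hg.lt_top).ne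
  have hgen : (inferInstance : MeasurableSpace (Icc (-r) (0 : ℝ))) =
      MeasurableSpace.generateFrom {s | ∃ a b, a ≤ b ∧ s = Ioc a b} := by
    have := borel_eq_generateFrom_Ioc_le (Icc (-r) (0 : ℝ))
    rw [← BorelSpace.measurable_eq] at this
    refine Eq.trans this ?_
    congr 1
    ext s
    simp only [mem_ofPred_eq]
    grind only
  have huniv : (univ : Set (Icc (-r) (0 : ℝ))) = {l} ∪ Ioc l u := by
    ext y
    simp only [mem_univ, singleton_union, mem_insert_iff, mem_Ioc, true_iff]
    rcases eq_or_lt_of_le (show l ≤ y from y.2.1) with h | h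
    · exact Or.inl h.symm
    · exact Or.inr ⟨h, y.2.2⟩
  have : Nonempty (Icc (-r) (0 : ℝ)) := ⟨l⟩
  obtain ⟨m, hm, hm'⟩ :=
    VectorMeasure.exists_extension_of_isSetSemiring_of_le_measure_of_generateFrom
      (μ := ν) (m := AddContent.onIoc g) IsSetSemiring.Ioc (by
        rintro s ⟨a, b, hab, rfl⟩
        rw [AddContent.onIoc_apply hab, hIoc a b hab, ← edist_eq_enorm_sub]
        exact eVariationOn.edist_le _ (by grind) (by grind)) hgen
  have hbot : ν {l} = 0 := by
    have := (hg.stieltjesFunctionRightLim l).measure_botSet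
    rwa [botSet_eq_singleton_of_isBot (x := l) fun y => y.2.1] at this
  have hml : m {l} = 0 := enorm_eq_zero.1 (le_bot_iff.1 ((hm' _).trans hbot.le))
  have hmIoc : ∀ a b, a ≤ b → hg.vectorMeasure (Ioc a b) = m (Ioc a b) := fun a b hab => by
    rw [hm _ ⟨a, b, hab, rfl⟩, AddContent.onIoc_apply hab, hg.vectorMeasure_Ioc hab, hlim]
  have hmeq : hg.vectorMeasure = m := by
    refine VectorMeasure.ext_of_generateFrom _ ?_ hgen
      (fun s hs t ht _ => IsSetSemiring.Ioc.inter_mem s hs t ht) ?_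
    · rintro s ⟨a, b, hab, rfl⟩
      exact hmIoc a b hab
    · rw [huniv, VectorMeasure.of_union (by simp) (measurableSet_singleton _) measurableSet_Ioc,
        VectorMeasure.of_union (by simp) (measurableSet_singleton _) measurableSet_Ioc, hml,
        hmIoc _ _ h0, hg.vectorMeasure_singleton, hlim, hlim', sub_self]
  have hle : hg.vectorMeasure.variation ≤ ν := by
    rw [hmeq]
    exact VectorMeasure.variation_le_of_forall_enorm_le fun s _ => hm' s
  calc hg.vectorMeasure.variation univ ≤ ν univ := hle _
    _ = ν ({l} ∪ Ioc l u) := by rw [← huniv]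
    _ ≤ ν {l} + ν (Ioc l u) := measure_union_le _ _
    _ ≤ eVariationOn g univ := by
        rw [hbot, zero_add, hIoc l u h0]
        exact eVariationOn.mono _ (subset_univ _)

theorem integrable_variation_of_continuous {X : Type*} [NormedAddCommGroup X]
    (μ : SignedMeasure (Icc (-r) (0 : ℝ))) {f : Icc (-r) (0 : ℝ) → X} (hf : Continuous f) :
    μ.Integrable f :=
  hf.integrable_of_hasCompactSupport (HasCompactSupport.of_compactSpace f)

variable {X : Type*} [NormedAddCommGroup X] [NormedSpace ℝ X]

theorem stieltjesIntegral_add {f : Icc (-r) (0 : ℝ) → X} (hf : Continuous f)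
    {g₁ g₂ : Icc (-r) (0 : ℝ) → ℝ} (h₁ : BoundedVariationOn g₁ univ)
    (h₂ : BoundedVariationOn g₂ univ) :
    stieltjesIntegral f (fun θ => g₁ θ + g₂ θ) =
      stieltjesIntegral f g₁ + stieltjesIntegral f g₂ := by
  have h := h₁.fun_add h₂
  rw [stieltjesIntegral, stieltjesIntegral, stieltjesIntegral, dif_pos h, dif_pos h₁, dif_pos h₂,
    h₁.vectorMeasure_add h₂ h]
  exact integral_add_vectorMeasure (integrable_variation_of_continuous _ hf)
    (integrable_variation_of_continuous _ hf)

theorem stieltjesIntegral_sub_left {f₁ f₂ : Icc (-r) (0 : ℝ) → X} (hf₁ : Continuous f₁)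
    (hf₂ : Continuous f₂) (g : Icc (-r) (0 : ℝ) → ℝ) :
    stieltjesIntegral (fun θ => f₁ θ - f₂ θ) g =
      stieltjesIntegral f₁ g - stieltjesIntegral f₂ g := by
  by_cases h : BoundedVariationOn g univ
  · simp only [stieltjesIntegral, dif_pos h]
    exact integral_fun_sub (integrable_variation_of_continuous _ hf₁)
      (integrable_variation_of_continuous _ hf₂)
  · simp [stieltjesIntegral, dif_neg h]

theorem norm_stieltjesIntegral_le {f : Icc (-r) (0 : ℝ) → X} {g : Icc (-r) (0 : ℝ) → ℝ}
    (hg : Continuous g) {C V : ℝ} (hC : 0 ≤ C) (hV : 0 ≤ V) (hf : ∀ θ, ‖f θ‖ ≤ C)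
    (hgV : eVariationOn g univ ≤ ENNReal.ofReal V) : ‖stieltjesIntegral f g‖ ≤ C * V := by
  have h : BoundedVariationOn g univ := ne_top_of_le_ne_top ENNReal.ofReal_ne_top hgV
  rw [stieltjesIntegral, dif_pos h]
  refine (VectorMeasure.norm_integral_le_of_norm_le_const (Eventually.of_forall hf)).trans ?_
  have h1 : ‖(ContinuousLinearMap.lsmul ℝ ℝ : ℝ →L[ℝ] X →L[ℝ] X).flip‖ ≤ 1 := by
    rw [ContinuousLinearMap.opNorm_flip]
    exact ContinuousLinearMap.opNorm_lsmul_le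
  have h2 : h.vectorMeasure.variation.real univ ≤ V :=
    ENNReal.toReal_le_of_le_ofReal hV ((h.variation_vectorMeasure_univ_le hg).trans hgV)
  have h3 : C * ‖(ContinuousLinearMap.lsmul ℝ ℝ : ℝ →L[ℝ] X →L[ℝ] X).flip‖ ≤ C * 1 := by gcongr
  calc _ ≤ C * 1 * V := by gcongr
    _ = C * V := by ring

/-- The finite measure `∑ cₖ δ_{xₖ}` for a summable sequence of weights `cₖ ≥ 0`. -/
noncomputable def diracSum {α : Type*} [MeasurableSpace α] (c : ℕ → ℝ) (x : ℕ → α) : Measure α :=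
  Measure.sum fun k => ENNReal.ofReal (c k) • Measure.dirac (x k)

theorem diracSum_apply {α : Type*} [MeasurableSpace α] {c : ℕ → ℝ} (hc : ∀ k, 0 ≤ c k)
    (hs : Summable c) (x : ℕ → α) {s : Set α} (hms : MeasurableSet s) :
    diracSum c x s = ENNReal.ofReal (∑' k, s.indicator (fun _ => c k) (x k)) := by
  rw [ENNReal.ofReal_tsum_of_nonneg (fun k => indicator_nonneg (fun _ _ => hc k) _)]
  · rw [diracSum, Measure.sum_apply _ hms]
    refine tsum_congr fun k => ?_
    by_cases hk : x k ∈ s <;> simp [hk, hms]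
  · refine hs.of_nonneg_of_le (fun k => indicator_nonneg (fun _ _ => hc k) _) fun k => ?_
    exact indicator_le_self' (fun _ _ => hc k) _

theorem isFiniteMeasure_diracSum {α : Type*} [MeasurableSpace α] {c : ℕ → ℝ} (hc : ∀ k, 0 ≤ c k)
    (hs : Summable c) (x : ℕ → α) : IsFiniteMeasure (diracSum c x) :=
  ⟨by rw [diracSum_apply hc hs x MeasurableSet.univ]; exact ENNReal.ofReal_lt_top⟩

theorem integral_diracSum [CompleteSpace X] {α : Type*} [MeasurableSpace α]
    [MeasurableSingletonClass α] {c : ℕ → ℝ}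
    (hc : ∀ k, 0 ≤ c k) (x : ℕ → α) {f : α → X} (hf : Integrable f (diracSum c x)) :
    HasSum (fun k => c k • f (x k)) (∫ y, f y ∂(diracSum c x)) := by
  simpa [hc, diracSum] using hasSum_integral_measure hf

open scoped Classical in
/-- A step function generates the measure `∑ cₖ δ_{xₖ}`, if its jumps are those of this measure. -/
theorem stieltjesIntegral_of_isStepFunction [CompleteSpace X] {f : Icc (-r) (0 : ℝ) → X}
    (hf : Continuous f) {g : Icc (-r) (0 : ℝ) → ℝ} (hg : IsStepFunction g) {c : ℕ → ℝ}
    (hc : Summable fun k => |c k|) (x : ℕ → Icc (-r) (0 : ℝ))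
    (hjump : ∀ θ, jump g θ = ∑' k, if θ = x k then c k else 0) :
    HasSum (fun k => c k • f (x k)) (stieltjesIntegral f g) := by
  set cp : ℕ → ℝ := fun k => max (c k) 0
  set cm : ℕ → ℝ := fun k => max (-c k) 0
  have hcp : ∀ k, 0 ≤ cp k := fun k => le_max_right _ _
  have hcm : ∀ k, 0 ≤ cm k := fun k => le_max_right _ _
  have hsp : Summable cp :=
    hc.of_nonneg_of_le hcp fun k => max_le (le_abs_self _) (abs_nonneg _)
  have hsm : Summable cm :=
    hc.of_nonneg_of_le hcm fun k => max_le (neg_le_abs _) (abs_nonneg _)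
  have hcc : ∀ k, cp k - cm k = c k := fun k => by
    simp only [cp, cm]
    exact posPart_sub_negPart (c k)
  have := isFiniteMeasure_diracSum hcp hsp x
  have := isFiniteMeasure_diracSum hcm hsm x
  have hmeas : hg.1.vectorMeasure =
      (diracSum cp x).toSignedMeasure - (diracSum cm x).toSignedMeasure := by
    refine signedMeasure_ext_Icc fun a b hab => ?_
    have hind : ∀ c' : ℕ → ℝ, (∀ k, 0 ≤ c' k) → Summable c' →
        Summable fun k => (Icc a b).indicator (fun _ => c' k) (x k) := fun c' h0 hs =>
      hs.of_nonneg_of_le (fun k => indicator_nonneg (fun _ _ => h0 k) _) fun k =>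
        indicator_le_self' (fun _ _ => h0 k) _
    have hR : ∀ c' : ℕ → ℝ, (∀ k, 0 ≤ c' k) → Summable c' → (diracSum c' x).real (Icc a b) =
        ∑' k, (Icc a b).indicator (fun _ => c' k) (x k) := fun c' h0 hs => by
      rw [Measure.real, diracSum_apply h0 hs x measurableSet_Icc, ENNReal.toReal_ofReal]
      exact tsum_nonneg fun k => indicator_nonneg (fun _ _ => h0 k) _
    rw [hg.1.vectorMeasure_Icc hab, ← (hg.2 a b hab).tsum_eq, _root_.sub_apply,
      Measure.toSignedMeasure_apply_measurable measurableSet_Icc,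
      Measure.toSignedMeasure_apply_measurable measurableSet_Icc, hR cp hcp hsp, hR cm hcm hsm,
      ← (hind cp hcp hsp).tsum_sub (hind cm hcm hsm)]
    simp only [hjump]
    have hsum : Summable (Function.uncurry fun (s : Icc a b) (k : ℕ) =>
        if (s : Icc (-r) (0 : ℝ)) = x k then c k else 0) := by
      have hinj : Function.Injective
          fun k : {k // x k ∈ Icc a b} => ((⟨x k, k.2⟩ : Icc a b), (k : ℕ)) :=
        fun k l hkl => Subtype.ext (Prod.ext_iff.1 hkl).2
      refine (hinj.summable_iff ?_).1 ?_
      · rintro ⟨s, k⟩ hsk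
        simp only [Function.uncurry_apply_pair]
        rw [if_neg]
        rintro h
        exact hsk ⟨⟨k, h ▸ s.2⟩, Prod.ext (Subtype.ext h.symm) rfl⟩
      · simpa [Function.comp_def] using hc.of_abs.comp_injective Subtype.val_injective
    -- Each `k` with `x k ∈ [a, b]` contributes to exactly one point of `[a, b]`.
    rw [← hsum.tsum_comm]
    refine tsum_congr fun k => ?_
    by_cases hk : x k ∈ Icc a b
    · rw [tsum_eq_single ⟨x k, hk⟩]
      · simp [hk, hcc]
      · intro s hs
        rw [if_neg]
        exact fun h => hs (Subtype.ext h)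
    · simp only [indicator_of_notMem hk, sub_self]
      rw [tsum_congr (g := fun _ => (0 : ℝ)), tsum_zero]
      intro s
      rw [if_neg]
      exact fun h => hk (h ▸ s.2)
  rw [stieltjesIntegral, dif_pos hg.1, hmeas]
  rw [integral_sub_vectorMeasure (integrable_variation_of_continuous _ hf)
    (integrable_variation_of_continuous _ hf), integral_toSignedMeasure, integral_toSignedMeasure]
  have hint : ∀ μ : Measure (Icc (-r) (0 : ℝ)), IsFiniteMeasure μ → Integrable f μ := fun μ _ =>
    hf.integrable_of_hasCompactSupport (HasCompactSupport.of_compactSpace f)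
  convert (integral_diracSum hcp x (hint _ ‹_›)).sub (integral_diracSum hcm x (hint _ ‹_›))
    using 2 with k
  rw [← sub_smul, hcc]

end Stieltjes

/-! ### The delay functional -/

section DelayFunctional

variable {X : Type*} [NormedAddCommGroup X] {r : ℝ}

/-- The point `-η_k(t, φ)` of `[-r, 0]`. -/
def HasContinuousJumps.delayPt {gd : Icc (-r) (0 : ℝ) → ℝ → HistorySpace r X → ℝ}
    {η h : ℕ → ℝ → HistorySpace r X → ℝ} (hgd : HasContinuousJumps gd η h) (k : ℕ) (t : ℝ)
    (φ : HistorySpace r X) : Icc (-r) (0 : ℝ) :=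
  ⟨-η k t φ, neg_le_neg (hgd.delay_mem k t φ).2, neg_nonpos.2 (hgd.delay_mem k t φ).1⟩

theorem HasContinuousJumps.continuous_delayPt
    {gd : Icc (-r) (0 : ℝ) → ℝ → HistorySpace r X → ℝ}
    {η h : ℕ → ℝ → HistorySpace r X → ℝ} (hgd : HasContinuousJumps gd η h) (k : ℕ) :
    Continuous fun x : ℝ × HistorySpace r X => hgd.delayPt k x.1 x.2 :=
  (hgd.delay_continuous k).neg.subtype_mk _

/-- In particular `∑ |h_k|` is locally bounded. The bound on the variation of `g` would not give
this, since jumps at coinciding delays may cancel. -/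
theorem HasContinuousJumps.continuous_tsum_abs
    {gd : Icc (-r) (0 : ℝ) → ℝ → HistorySpace r X → ℝ}
    {η h : ℕ → ℝ → HistorySpace r X → ℝ} (hgd : HasContinuousJumps gd η h) :
    Continuous fun x : ℝ × HistorySpace r X => ∑' k, |h k x.1 x.2| := by
  refine continuous_iff_continuousAt.2 fun x => ?_
  refine ((hgd.uniform_jump (Metric.ball x 1) Metric.isBounded_ball).continuousOn
    (Frequently.of_forall fun n => ?_)).continuousAt (Metric.ball_mem_nhds x one_pos)
  exact (continuous_finsetSum _ fun k _ => (hgd.jump_continuous k).abs).continuousOn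

variable [NormedSpace ℝ X]

/-- The part of the delay functional that is generated by the jumps of `g`. -/
noncomputable def HasContinuousJumps.discretePart
    {gd : Icc (-r) (0 : ℝ) → ℝ → HistorySpace r X → ℝ}
    {η h : ℕ → ℝ → HistorySpace r X → ℝ} (hgd : HasContinuousJumps gd η h) (p : ℝ → X → X)
    (t : ℝ) (φ : HistorySpace r X) : X :=
  ∑' k, h k t φ • p t (φ (hgd.delayPt k t φ))

omit [NormedSpace ℝ X] in
theorem IsSplitting.boundedVariationOn
    {g gd gc : Icc (-r) (0 : ℝ) → ℝ → HistorySpace r X → ℝ} (hsplit : IsSplitting g gd gc)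
    (hg : HasUniformlyBoundedVariation g) (t : ℝ) (φ : HistorySpace r X) :
    BoundedVariationOn (fun θ => gc θ t φ) univ := by
  obtain ⟨hstep, -, hsum⟩ := hsplit t φ
  obtain ⟨M, -, hM⟩ := hg
  have hgBV : BoundedVariationOn (fun θ => g θ t φ) univ :=
    ne_top_of_le_ne_top ENNReal.ofReal_ne_top (hM t φ)
  have : (fun θ => gc θ t φ) = fun θ => g θ t φ + -gd θ t φ := by
    funext θ
    rw [hsum]
    ring
  rw [this]
  exact hgBV.fun_add hstep.1.fun_neg

/-- `F(t, φ) = ∫ p(t, φ(θ)) dg_c(θ, t, φ) + ∑ h_k(t, φ) p(t, φ(-η_k(t, φ)))`. -/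
theorem delayFunctional_eq_add [CompleteSpace X]
    {g gd gc : Icc (-r) (0 : ℝ) → ℝ → HistorySpace r X → ℝ} {η h : ℕ → ℝ → HistorySpace r X → ℝ}
    (hg : HasUniformlyBoundedVariation g) (hsplit : IsSplitting g gd gc)
    (hgd : HasContinuousJumps gd η h) {p : ℝ → X → X} (hp : ∀ t, Continuous (p t)) (t : ℝ)
    (φ : HistorySpace r X) :
    delayFunctional p g t φ = delayFunctional p gc t φ + hgd.discretePart p t φ := by
  obtain ⟨hstep, -, hsum⟩ := hsplit t φ
  have hf : Continuous fun θ => p t (φ θ) := (hp t).comp φ.continuous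
  have hgcBV := hsplit.boundedVariationOn hg t φ
  have hd : stieltjesIntegral (fun θ => p t (φ θ)) (fun θ => gd θ t φ) =
      hgd.discretePart p t φ := by
    classical
    refine (stieltjesIntegral_of_isStepFunction hf hstep (hgd.summable_jump t φ)
      (fun k => hgd.delayPt k t φ) fun θ => ?_).tsum_eq.symm
    rw [hgd.jump_eq]
    refine tsum_congr fun k => ?_
    simp only [Subtype.ext_iff]
    congr
  rw [delayFunctional, delayFunctional, ← hd, ← stieltjesIntegral_add hf hgcBV hstep.1]
  congr 1
  funext θ
  rw [hsum, add_comm]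

/-- The part of the delay functional that is generated by `g_c` is locally Lipschitz, by
`∫ f₁ dg₁ - ∫ f₂ dg₂ = ∫ (f₁ - f₂) dg₁ + ∫ f₂ d(g₁ - g₂)`. -/
theorem norm_delayFunctional_sub_le {a : ℝ} {gc : Icc (-r) (0 : ℝ) → ℝ → HistorySpace r X → ℝ}
    (hcont : ∀ t φ, Continuous fun θ => gc θ t φ) {L V : ℝ} (hL : 0 ≤ L) (hV : 0 ≤ V)
    (hgc : ∀ t₁ t₂ : ℝ, a ≤ t₁ → a ≤ t₂ → ∀ φ ψ : HistorySpace r X,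
      eVariationOn (fun θ => gc θ t₁ φ - gc θ t₂ ψ) univ ≤
        ENNReal.ofReal (L * (|t₁ - t₂| + ‖φ - ψ‖)))
    (hgcV : eVariationOn (fun θ => gc θ a 0) univ ≤ ENNReal.ofReal V)
    {p : ℝ → X → X} {Lp C₁ C₂ : ℝ} (hLp : 0 ≤ Lp) (hC₁ : 0 ≤ C₁) (hC₂ : 0 ≤ C₂)
    (hp : ∀ (t s : ℝ) (u v : X), ‖p t u - p s v‖ ≤ Lp * (|s - t| + ‖u - v‖))
    (hpG : ∀ (s : ℝ) (u : X), ‖p s u‖ ≤ C₁ * ‖u‖ + C₂)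
    {t₁ t₂ : ℝ} (h₁ : a ≤ t₁) (h₂ : a ≤ t₂) (φ ψ : HistorySpace r X) :
    ‖delayFunctional p gc t₁ φ - delayFunctional p gc t₂ ψ‖ ≤
      (Lp * (V + L * (|t₁ - a| + ‖φ‖)) + (C₁ * ‖ψ‖ + C₂) * L) * (|t₁ - t₂| + ‖φ - ψ‖) := by
  have hpc : ∀ t, Continuous (p t) := fun t => by
    refine (LipschitzWith.of_dist_le_mul (K := ⟨Lp, hLp⟩) fun u v => ?_).continuous
    have := hp t t u v
    rwa [sub_self, abs_zero, zero_add, ← dist_eq_norm, ← dist_eq_norm] at this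
  have hdiff : 0 ≤ L * (|t₁ - t₂| + ‖φ - ψ‖) := by positivity
  have hf₁ : Continuous fun θ => p t₁ (φ θ) := (hpc t₁).comp φ.continuous
  have hf₂ : Continuous fun θ => p t₂ (ψ θ) := (hpc t₂).comp ψ.continuous
  have hvar : ∀ t, a ≤ t → ∀ φ : HistorySpace r X, eVariationOn (fun θ => gc θ t φ) univ ≤
      ENNReal.ofReal (V + L * (|t - a| + ‖φ‖)) := by
    intro t ht φ
    have h1 := eVariationOn_fun_add_le (fun θ => gc θ a 0) (fun θ => gc θ t φ - gc θ a 0) univ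
    simp only [add_sub_cancel] at h1
    have h2 := hgc t a ht le_rfl φ 0
    rw [sub_zero] at h2
    rw [ENNReal.ofReal_add hV (by positivity)]
    exact h1.trans (add_le_add hgcV h2)
  have hsplit : delayFunctional p gc t₁ φ - delayFunctional p gc t₂ ψ =
      stieltjesIntegral (fun θ => p t₁ (φ θ) - p t₂ (ψ θ)) (fun θ => gc θ t₁ φ) +
        stieltjesIntegral (fun θ => p t₂ (ψ θ)) (fun θ => gc θ t₁ φ - gc θ t₂ ψ) := by
    have h1 := stieltjesIntegral_add hf₂ (g₁ := fun θ => gc θ t₂ ψ)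
      (g₂ := fun θ => gc θ t₁ φ - gc θ t₂ ψ)
      (ne_top_of_le_ne_top ENNReal.ofReal_ne_top (hvar t₂ h₂ ψ))
      (ne_top_of_le_ne_top ENNReal.ofReal_ne_top (hgc t₁ t₂ h₁ h₂ φ ψ))
    simp only [add_sub_cancel] at h1
    rw [stieltjesIntegral_sub_left hf₁ hf₂, h1, delayFunctional, delayFunctional]
    abel
  have hI₁ : ‖stieltjesIntegral (fun θ => p t₁ (φ θ) - p t₂ (ψ θ)) (fun θ => gc θ t₁ φ)‖ ≤
      (Lp * (|t₁ - t₂| + ‖φ - ψ‖)) * (V + L * (|t₁ - a| + ‖φ‖)) := by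
    refine norm_stieltjesIntegral_le (hcont _ _) (by positivity) (by positivity) (fun θ => ?_)
      (hvar t₁ h₁ φ)
    refine (hp _ _ _ _).trans ?_
    rw [abs_sub_comm]
    gcongr
    exact (φ - ψ).norm_coe_le_norm θ
  have hI₂ : ‖stieltjesIntegral (fun θ => p t₂ (ψ θ)) (fun θ => gc θ t₁ φ - gc θ t₂ ψ)‖ ≤
      (C₁ * ‖ψ‖ + C₂) * (L * (|t₁ - t₂| + ‖φ - ψ‖)) := by
    refine norm_stieltjesIntegral_le ((hcont _ _).sub (hcont _ _)) (by positivity) hdiff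
      (fun θ => ?_) (hgc t₁ t₂ h₁ h₂ φ ψ)
    refine (hpG _ _).trans ?_
    gcongr
    exact ψ.norm_coe_le_norm θ
  rw [hsplit]
  refine (norm_add_le _ _).trans ((add_le_add hI₁ hI₂).trans (le_of_eq ?_))
  ring

/-- The discrete part is continuous as a locally uniform limit of finite sums. In general it is not
Lipschitz, as nothing is assumed on the moduli of continuity of `η_k` and `h_k`. -/
theorem HasContinuousJumps.continuous_discretePart [CompleteSpace X]
    {gd : Icc (-r) (0 : ℝ) → ℝ → HistorySpace r X → ℝ}
    {η h : ℕ → ℝ → HistorySpace r X → ℝ} (hgd : HasContinuousJumps gd η h)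
    {p : ℝ → X → X} {C₁ C₂ : ℝ} (hC₁ : 0 ≤ C₁) (hC₂ : 0 ≤ C₂)
    (hp : Continuous (Function.uncurry p)) (hpG : ∀ (s : ℝ) (u : X), ‖p s u‖ ≤ C₁ * ‖u‖ + C₂) :
    Continuous fun x : ℝ × HistorySpace r X => hgd.discretePart p x.1 x.2 := by
  refine continuous_iff_continuousAt.2 fun x₀ => ?_
  set K : ℝ := C₁ * (‖x₀.2‖ + 1) + C₂
  have hK : 0 ≤ K := by positivity
  have hterm : ∀ x ∈ Metric.ball x₀ 1, ∀ k,
      ‖h k x.1 x.2 • p x.1 (x.2 (hgd.delayPt k x.1 x.2))‖ ≤ K * |h k x.1 x.2| := by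
    intro x hx k
    rw [norm_smul, Real.norm_eq_abs, mul_comm]
    have h1 : ‖x.2‖ ≤ ‖x₀.2‖ + 1 := by
      have h2 : dist x.2 x₀.2 ≤ 1 := (le_max_right _ _).trans (Metric.mem_ball.1 hx).le
      rw [dist_eq_norm] at h2
      linarith [norm_le_norm_add_norm_sub' x.2 x₀.2]
    gcongr
    refine (hpG _ _).trans ?_
    simp only [K]
    gcongr
    exact (x.2.norm_coe_le_norm _).trans h1
  have hunif : TendstoUniformlyOn (fun (n : ℕ) (x : ℝ × HistorySpace r X) =>
      ∑ k ∈ Finset.range n, h k x.1 x.2 • p x.1 (x.2 (hgd.delayPt k x.1 x.2)))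
      (fun x => hgd.discretePart p x.1 x.2) atTop (Metric.ball x₀ 1) := by
    rw [Metric.tendstoUniformlyOn_iff]
    intro ε hε
    have h1 := Metric.tendstoUniformlyOn_iff.1
      (hgd.uniform_jump (Metric.ball x₀ 1) Metric.isBounded_ball) (ε / (K + 1)) (by positivity)
    filter_upwards [h1] with n hn x hx
    have hs := hgd.summable_jump x.1 x.2
    have hs' : Summable fun k => h k x.1 x.2 • p x.1 (x.2 (hgd.delayPt k x.1 x.2)) :=
      Summable.of_norm_bounded (hs.mul_left K) (hterm x hx)
    have h2 : (∑' k, |h k x.1 x.2|) - ∑ k ∈ Finset.range n, |h k x.1 x.2| =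
        ∑' k, |h (k + n) x.1 x.2| := by
      rw [← hs.sum_add_tsum_nat_add n]; ring
    have h3 : hgd.discretePart p x.1 x.2 -
        ∑ k ∈ Finset.range n, h k x.1 x.2 • p x.1 (x.2 (hgd.delayPt k x.1 x.2)) =
        ∑' k, h (k + n) x.1 x.2 • p x.1 (x.2 (hgd.delayPt (k + n) x.1 x.2)) := by
      rw [discretePart, ← hs'.sum_add_tsum_nat_add n, add_sub_cancel_left]
    have h4 := hn x hx
    rw [Real.dist_eq, h2, abs_of_nonneg (tsum_nonneg fun _ => abs_nonneg _)] at h4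
    rw [dist_eq_norm, h3]
    have hsn := (summable_nat_add_iff n).2 hs
    calc _ ≤ ∑' k, K * |h (k + n) x.1 x.2| :=
          tsum_of_norm_bounded (hsn.mul_left K).hasSum fun k => hterm x hx (k + n)
      _ = K * ∑' k, |h (k + n) x.1 x.2| := tsum_mul_left
      _ ≤ K * (ε / (K + 1)) := by gcongr
      _ < ε := by
          rw [mul_div_assoc', div_lt_iff₀ (by positivity)]
          nlinarith
  refine (hunif.continuousOn (Frequently.of_forall fun n => ?_)).continuousAt
    (Metric.ball_mem_nhds x₀ one_pos)
  refine (continuous_finsetSum _ fun k _ => (hgd.jump_continuous k).smul ?_).continuousOn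
  exact hp.comp (continuous_fst.prodMk
    (continuous_snd.eval (hgd.continuous_delayPt k)))

/-- Continuity of `F` on `[a, ∞) × C`. Composing with `t ↦ max t a` makes it a statement on `ℝ × C`;
no regularity of `g_c` in variation is available for `t < a`. -/
theorem continuous_delayFunctional [CompleteSpace X] {a : ℝ}
    {g gd gc : Icc (-r) (0 : ℝ) → ℝ → HistorySpace r X → ℝ} {η h : ℕ → ℝ → HistorySpace r X → ℝ}
    (hg : HasUniformlyBoundedVariation g) (hsplit : IsSplitting g gd gc)
    (hgd : HasContinuousJumps gd η h) {L V : ℝ} (hL : 0 ≤ L) (hV : 0 ≤ V)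
    (hgc : ∀ t₁ t₂ : ℝ, a ≤ t₁ → a ≤ t₂ → ∀ φ ψ : HistorySpace r X,
      eVariationOn (fun θ => gc θ t₁ φ - gc θ t₂ ψ) univ ≤
        ENNReal.ofReal (L * (|t₁ - t₂| + ‖φ - ψ‖)))
    (hgcV : eVariationOn (fun θ => gc θ a 0) univ ≤ ENNReal.ofReal V)
    {p : ℝ → X → X} {Lp C₁ C₂ : ℝ} (hLp : 0 ≤ Lp) (hC₁ : 0 ≤ C₁) (hC₂ : 0 ≤ C₂)
    (hp : ∀ (t s : ℝ) (u v : X), ‖p t u - p s v‖ ≤ Lp * (|s - t| + ‖u - v‖))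
    (hpG : ∀ (s : ℝ) (u : X), ‖p s u‖ ≤ C₁ * ‖u‖ + C₂)
    (hpc : Continuous (Function.uncurry p)) :
    Continuous fun x : ℝ × HistorySpace r X => delayFunctional p g (max x.1 a) x.2 := by
  have hpt : ∀ t, Continuous (p t) := fun t => hpc.comp (Continuous.prodMk_right t)
  simp only [delayFunctional_eq_add hg hsplit hgd hpt]
  refine Continuous.add ?_ ((hgd.continuous_discretePart hC₁ hC₂ hpc hpG).comp
    ((continuous_fst.max continuous_const).prodMk continuous_snd))
  refine continuous_iff_continuousAt.2 fun x₀ => ?_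
  refine tendsto_iff_norm_sub_tendsto_zero.2 ?_
  refine squeeze_zero (fun _ => norm_nonneg _) (fun x =>
    norm_delayFunctional_sub_le (fun t φ => (hsplit t φ).2.1) hL hV hgc hgcV hLp hC₁ hC₂ hp hpG
      (le_max_right _ _) (le_max_right _ _) _ _) ?_
  have hcont : Continuous fun x : ℝ × HistorySpace r X =>
      (Lp * (V + L * (|max x.1 a - a| + ‖x.2‖)) + (C₁ * ‖x₀.2‖ + C₂) * L) *
        (|max x.1 a - max x₀.1 a| + ‖x.2 - x₀.2‖) := by fun_prop
  simpa using hcont.tendsto x₀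

/-- `B` is locally Lipschitz in the histories that share their past: near every `(t₀, φ₀)`,
`B(t, ·)` is Lipschitz on pairs of histories at time `t` that agree up to some earlier time `s`.
This is what makes a contraction argument possible when `B(t, ·)` itself is not Lipschitz. -/
def LipschitzForCommonPast (a : ℝ) (B : ℝ → HistorySpace r X → X) : Prop :=
  ∀ t₀, a ≤ t₀ → ∀ φ₀ : HistorySpace r X, ∃ δ > 0, ∃ L ≥ 0, ∀ s t, a ≤ s → t₀ - δ ≤ s → s < t →
    t ≤ t₀ + δ → ∀ φ ψ : HistorySpace r X, ‖φ - φ₀‖ ≤ δ → ‖ψ - φ₀‖ ≤ δ →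
      (∀ θ : Icc (-r) (0 : ℝ), (θ : ℝ) ≤ s - t → φ θ = ψ θ) → ‖B t φ - B t ψ‖ ≤ L * ‖φ - ψ‖

/-- The discrete part is Lipschitz on pairs of histories that have the same delays and jumps. -/
theorem HasContinuousJumps.norm_discretePart_sub_le [CompleteSpace X]
    {gd : Icc (-r) (0 : ℝ) → ℝ → HistorySpace r X → ℝ}
    {η h : ℕ → ℝ → HistorySpace r X → ℝ} (hgd : HasContinuousJumps gd η h)
    {p : ℝ → X → X} {Lp C₁ C₂ : ℝ} (hLp : 0 ≤ Lp) (hC₁ : 0 ≤ C₁)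
    (hp : ∀ (t s : ℝ) (u v : X), ‖p t u - p s v‖ ≤ Lp * (|s - t| + ‖u - v‖))
    (hpG : ∀ (s : ℝ) (u : X), ‖p s u‖ ≤ C₁ * ‖u‖ + C₂) {t : ℝ} {φ ψ : HistorySpace r X}
    (heq : ∀ k, η k t φ = η k t ψ ∧ h k t φ = h k t ψ) :
    ‖hgd.discretePart p t φ - hgd.discretePart p t ψ‖ ≤
      (∑' k, |h k t φ|) * (Lp * ‖φ - ψ‖) := by
  have hs := hgd.summable_jump t φ
  have hsum : ∀ x : ℕ → Icc (-r) (0 : ℝ), ∀ χ : HistorySpace r X,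
      Summable fun k => h k t φ • p t (χ (x k)) := fun x χ => by
    refine Summable.of_norm_bounded (hs.mul_right (C₁ * ‖χ‖ + C₂)) fun k => ?_
    rw [norm_smul, Real.norm_eq_abs]
    gcongr
    refine (hpG _ _).trans ?_
    gcongr
    exact χ.norm_coe_le_norm _
  have h1 : hgd.discretePart p t ψ = ∑' k, h k t φ • p t (ψ (hgd.delayPt k t φ)) := by
    refine tsum_congr fun k => ?_
    have : hgd.delayPt k t φ = hgd.delayPt k t ψ := Subtype.ext (by simp [delayPt, (heq k).1])
    rw [(heq k).2, this]
  rw [h1, discretePart, ← (hsum _ φ).tsum_sub (hsum _ ψ), ← tsum_mul_right]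
  refine tsum_of_norm_bounded (hs.mul_right _).hasSum fun k => ?_
  rw [← smul_sub, norm_smul, Real.norm_eq_abs]
  gcongr
  refine (hp _ _ _ _).trans ?_
  rw [sub_self, abs_zero, zero_add]
  gcongr
  exact (φ - ψ).norm_coe_le_norm _

/-- The discrete part is controlled because two histories at time `t` that agree up to time `s`, with
`t - s < η_ign(t)`, have the same delays and jumps. -/
theorem lipschitzForCommonPast_delayTerm [CompleteSpace X] (hr : 0 < r) {a : ℝ}
    {g gd gc : Icc (-r) (0 : ℝ) → ℝ → HistorySpace r X → ℝ} {η h : ℕ → ℝ → HistorySpace r X → ℝ}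
    (hg : HasUniformlyBoundedVariation g) (hsplit : IsSplitting g gd gc)
    (hgd : HasContinuousJumps gd η h) (hign : IgnoresRecentHistory a η h)
    {L V : ℝ} (hL : 0 ≤ L) (hV : 0 ≤ V)
    (hgc : ∀ t₁ t₂ : ℝ, a ≤ t₁ → a ≤ t₂ → ∀ φ ψ : HistorySpace r X,
      eVariationOn (fun θ => gc θ t₁ φ - gc θ t₂ ψ) univ ≤
        ENNReal.ofReal (L * (|t₁ - t₂| + ‖φ - ψ‖)))
    (hgcV : eVariationOn (fun θ => gc θ a 0) univ ≤ ENNReal.ofReal V)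
    {p : ℝ → X → X} {Lp C₁ C₂ : ℝ} (hLp : 0 ≤ Lp) (hC₁ : 0 ≤ C₁) (hC₂ : 0 ≤ C₂)
    (hp : ∀ (t s : ℝ) (u v : X), ‖p t u - p s v‖ ≤ Lp * (|s - t| + ‖u - v‖))
    (hpG : ∀ (s : ℝ) (u : X), ‖p s u‖ ≤ C₁ * ‖u‖ + C₂)
    (hpc : Continuous (Function.uncurry p)) {G : ℝ → X → X → X}
    (hGLip : ∀ R : ℝ, 0 < R → ∃ L : ℝ, 0 < L ∧ ∀ t : ℝ, a < t → ∀ u₁ u₂ v₁ v₂ : X,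
      ‖u₁‖ ≤ R → ‖u₂‖ ≤ R → ‖v₁‖ ≤ R → ‖v₂‖ ≤ R →
        ‖G t u₁ v₁ - G t u₂ v₂‖ ≤ L * (‖u₁ - u₂‖ + ‖v₁ - v₂‖)) :
    LipschitzForCommonPast a (delayTerm hr G p g) := by
  intro t₀ ht₀ φ₀
  obtain ⟨ηign, hηc, hηpos, hη⟩ := hign
  have hpt : ∀ t, Continuous (p t) := fun t => hpc.comp (Continuous.prodMk_right t)
  have hηc' : Continuous fun x : ℝ × HistorySpace r X => ηign (max x.1 a) :=
    hηc.comp_continuous (continuous_fst.max continuous_const) fun x => mem_Ici.2 (le_max_right _ _)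
  set e := ηign t₀ with he
  have hepos : 0 < e := hηpos t₀ ht₀
  set N := ∑' k, |h k t₀ φ₀| with hN
  have hN0 : 0 ≤ N := tsum_nonneg fun _ => abs_nonneg _
  set F₀ := ‖delayFunctional p g t₀ φ₀‖ with hF₀
  have hnear : ∀ᶠ x : ℝ × HistorySpace r X in 𝓝 (t₀, φ₀),
      e / 2 < ηign (max x.1 a) ∧ ∑' k, |h k x.1 x.2| < N + 1 ∧
        ‖delayFunctional p g (max x.1 a) x.2‖ < F₀ + 1 := by
    refine (hηc'.continuousAt.eventually_const_lt ?_).and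
      ((hgd.continuous_tsum_abs.continuousAt.eventually_lt_const ?_).and
      ((continuous_delayFunctional hg hsplit hgd hL hV hgc hgcV hLp hC₁ hC₂ hp hpG
        hpc).norm.continuousAt.eventually_lt_const ?_))
    · simp only [max_eq_left ht₀]
      linarith
    · exact lt_add_one N
    · simp only [max_eq_left ht₀]
      exact lt_add_one F₀
  obtain ⟨ε, hε, hball⟩ := Metric.eventually_nhds_iff.1 hnear
  -- Then `t - s ≤ 2 * δ < e / 2 < η_ign(t)` for `s` and `t` in `[t₀ - δ, t₀ + δ]`.
  set δ := min (ε / 2) (e / 8) with hδ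
  have hδpos : 0 < δ := by positivity
  have hδε : δ < ε := (min_le_left _ _).trans_lt (by linarith)
  have hδe : δ ≤ e / 8 := min_le_right _ _
  set R := ‖φ₀‖ + δ + F₀ + 1 with hR
  have hRpos : 0 < R := by positivity
  obtain ⟨LG, hLG, hG⟩ := hGLip R hRpos
  set K := Lp * (V + L * (|t₀ - a| + δ + R)) + (C₁ * R + C₂) * L with hK
  have hK0 : 0 ≤ K := by positivity
  refine ⟨δ, hδpos, LG * (1 + (K + (N + 1) * Lp)), by positivity, ?_⟩
  intro s t has hs hst ht φ ψ hφ hψ hag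
  have hat : a < t := has.trans_lt hst
  have htδ : |t - t₀| ≤ δ := abs_le.2 ⟨by linarith, by linarith⟩
  have hmem : ∀ χ : HistorySpace r X, ‖χ - φ₀‖ ≤ δ →
      e / 2 < ηign (max t a) ∧ ∑' k, |h k t χ| < N + 1 ∧
        ‖delayFunctional p g (max t a) χ‖ < F₀ + 1 := fun χ hχ => by
    refine @hball (t, χ) ?_
    rw [Prod.dist_eq, max_lt_iff, Real.dist_eq, dist_eq_norm]
    exact ⟨htδ.trans_lt hδε, hχ.trans_lt hδε⟩
  have hnorm : ∀ χ : HistorySpace r X, ‖χ - φ₀‖ ≤ δ → ‖χ‖ ≤ ‖φ₀‖ + δ := fun χ hχ => by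
    linarith [norm_le_norm_add_norm_sub' χ φ₀]
  simp only [max_eq_left hat.le] at hmem
  have hF0 : 0 ≤ F₀ := norm_nonneg _
  have hR1 : ∀ χ : HistorySpace r X, ‖χ - φ₀‖ ≤ δ → ‖χ‖ ≤ R := fun χ hχ => by
    linarith [hnorm χ hχ]
  have hR2 : ∀ χ : HistorySpace r X, ‖χ - φ₀‖ ≤ δ → ‖delayFunctional p g t χ‖ ≤ R := by
    intro χ hχ
    linarith [(hmem χ hχ).2.2, norm_nonneg φ₀]
  have heq : ∀ k, η k t φ = η k t ψ ∧ h k t φ = h k t ψ := by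
    refine hη t hat.le φ ψ fun θ hθ => hag θ ?_
    linarith [(hmem φ hφ).1]
  have hFc : ‖delayFunctional p gc t φ - delayFunctional p gc t ψ‖ ≤ K * ‖φ - ψ‖ := by
    refine (norm_delayFunctional_sub_le (fun t φ => (hsplit t φ).2.1) hL hV hgc hgcV hLp hC₁ hC₂
      hp hpG hat.le hat.le φ ψ).trans ?_
    rw [sub_self, abs_zero, zero_add]
    have h1 : |t - a| ≤ |t₀ - a| + δ := by
      have := abs_sub_le t t₀ a
      linarith
    have h2 := hR1 φ hφ
    have h3 := hR1 ψ hψ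
    simp only [K]
    gcongr
  have hFd : ‖hgd.discretePart p t φ - hgd.discretePart p t ψ‖ ≤
      (N + 1) * Lp * ‖φ - ψ‖ := by
    refine (hgd.norm_discretePart_sub_le hLp hC₁ hp hpG heq).trans ?_
    rw [mul_assoc]
    gcongr
    exact (hmem φ hφ).2.1.le
  have hF : ‖delayFunctional p g t φ - delayFunctional p g t ψ‖ ≤
      (K + (N + 1) * Lp) * ‖φ - ψ‖ := by
    rw [delayFunctional_eq_add hg hsplit hgd hpt, delayFunctional_eq_add hg hsplit hgd hpt,
      add_sub_add_comm, add_mul]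
    exact (norm_add_le _ _).trans (add_le_add hFc hFd)
  have h0 : ‖φ (zeroPt hr) - ψ (zeroPt hr)‖ ≤ ‖φ - ψ‖ := (φ - ψ).norm_coe_le_norm _
  calc ‖delayTerm hr G p g t φ - delayTerm hr G p g t ψ‖
      ≤ LG * (‖φ (zeroPt hr) - ψ (zeroPt hr)‖ +
          ‖delayFunctional p g t φ - delayFunctional p g t ψ‖) :=
        hG t hat _ _ _ _ ((φ.norm_coe_le_norm _).trans (hR1 φ hφ))
          ((ψ.norm_coe_le_norm _).trans (hR1 ψ hψ)) (hR2 φ hφ) (hR2 ψ hψ)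
    _ ≤ LG * (‖φ - ψ‖ + (K + (N + 1) * Lp) * ‖φ - ψ‖) := by gcongr
    _ = _ := by ring

end DelayFunctional

/-! ### Semigroups, histories and mild solutions -/

section Semigroup

variable {X : Type*} [NormedAddCommGroup X] [NormedSpace ℝ X] {T : ℝ → X →L[ℝ] X}

theorem norm_semigroup_le {ω : ℝ} (hω : ∀ t : ℝ, 0 ≤ t → ‖T t‖ ≤ Real.exp (ω * t)) {t c : ℝ}
    (ht : 0 ≤ t) (htc : t ≤ c) : ‖T t‖ ≤ Real.exp (|ω| * c) :=
  (hω t ht).trans (Real.exp_le_exp.2 ((mul_le_mul_of_nonneg_right (le_abs_self ω) ht).trans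
    (mul_le_mul_of_nonneg_left htc (abs_nonneg ω))))

theorem IsC0Semigroup.norm_sub_le (hT : IsC0Semigroup T) {ω : ℝ}
    (hω : ∀ t : ℝ, 0 ≤ t → ‖T t‖ ≤ Real.exp (ω * t)) {s t c : ℝ} (hs : 0 ≤ s) (ht : 0 ≤ t)
    (hsc : s ≤ c) (htc : t ≤ c) (x : X) :
    ‖T s x - T t x‖ ≤ Real.exp (|ω| * c) * ‖T |s - t| x - x‖ := by
  wlog hst : t ≤ s generalizing s t
  · rw [norm_sub_rev, abs_sub_comm]
    exact this ht hs htc hsc (le_of_not_ge hst)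
  have h1 : T s x - T t x = T t (T |s - t| x - x) := by
    have h2 := hT.map_add t (s - t) ht (sub_nonneg.2 hst)
    rw [add_sub_cancel] at h2
    rw [abs_of_nonneg (sub_nonneg.2 hst), map_sub, h2]
    rfl
  rw [h1]
  exact (T t).le_of_opNorm_le (norm_semigroup_le hω ht htc) _

/-- A `C₀`-semigroup, extended to negative times by the identity, is jointly continuous. -/
theorem IsC0Semigroup.continuous_max (hT : IsC0Semigroup T) {ω : ℝ}
    (hω : ∀ t : ℝ, 0 ≤ t → ‖T t‖ ≤ Real.exp (ω * t)) :
    Continuous fun x : ℝ × X => T (max x.1 0) x.2 := by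
  refine continuous_iff_continuousAt.2 fun ⟨t, x⟩ => ?_
  refine tendsto_iff_norm_sub_tendsto_zero.2 ?_
  have hbd : ∀ᶠ y : ℝ × X in 𝓝 (t, x), ‖T (max y.1 0) y.2 - T (max t 0) x‖ ≤
      Real.exp (|ω| * (max t 0 + 1)) * ‖y.2 - x‖ + Real.exp (|ω| * (max t 0 + 1)) *
        ‖T |max y.1 0 - max t 0| x - x‖ := by
    have h1 : ∀ᶠ y : ℝ × X in 𝓝 (t, x), max y.1 0 < max t 0 + 1 :=
      (continuous_fst.max continuous_const).continuousAt.eventually_lt_const (lt_add_one _)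
    filter_upwards [h1] with y hy
    have h2 : T (max y.1 0) y.2 - T (max t 0) x =
        T (max y.1 0) (y.2 - x) + (T (max y.1 0) x - T (max t 0) x) := by
      rw [map_sub]; abel
    rw [h2]
    refine (norm_add_le _ _).trans (add_le_add ?_ ?_)
    · exact (T _).le_of_opNorm_le (norm_semigroup_le hω (le_max_right _ _) hy.le) _
    · exact hT.norm_sub_le hω (le_max_right _ _) (le_max_right _ _) hy.le (by linarith) x
  refine squeeze_zero' (Eventually.of_forall fun _ => norm_nonneg _) hbd ?_
  have h3 : Tendsto (fun y : ℝ × X => |max y.1 0 - max t 0|) (𝓝 (t, x)) (𝓝[≥] 0) := by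
    refine tendsto_nhdsWithin_iff.2 ⟨?_, Eventually.of_forall fun y => mem_Ici.2 (abs_nonneg _)⟩
    have : Continuous fun y : ℝ × X => |max y.1 0 - max t 0| := by fun_prop
    simpa using this.tendsto (t, x)
  have h4 := tendsto_iff_norm_sub_tendsto_zero.1 ((hT.tendsto_zero x).comp h3)
  have h5 : Tendsto (fun y : ℝ × X => ‖y.2 - x‖) (𝓝 (t, x)) (𝓝 0) := by
    have : Continuous fun y : ℝ × X => ‖y.2 - x‖ := by fun_prop
    simpa using this.tendsto (t, x)
  simpa using (h5.const_mul _).add (h4.const_mul _)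

theorem IsC0Semigroup.continuous_convolution (hT : IsC0Semigroup T) {ω : ℝ}
    (hω : ∀ t : ℝ, 0 ≤ t → ‖T t‖ ≤ Real.exp (ω * t)) {f : ℝ → X} (hf : Continuous f) (s : ℝ) :
    Continuous fun t => ∫ σ in s..t, T (max (t - σ) 0) (f σ) := by
  have h : Continuous (Function.uncurry fun t σ : ℝ => T (max (t - σ) 0) (f σ)) :=
    (hT.continuous_max hω).comp
      ((continuous_fst.sub continuous_snd).prodMk (hf.comp continuous_snd))
  exact intervalIntegral.continuous_parametric_intervalIntegral_of_continuous h continuous_id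

end Semigroup

section History

variable {X : Type*} [NormedAddCommGroup X] {r : ℝ}

theorem continuous_shift {u : ℝ → X} {t : ℝ} (hu : ContinuousOn u (Icc (t - r) t)) :
    Continuous fun θ : Icc (-r) (0 : ℝ) => u (t + θ) :=
  hu.comp_continuous (by fun_prop) fun θ => ⟨by linarith [θ.2.1], by linarith [θ.2.2]⟩

theorem history_apply {u : ℝ → X} {t : ℝ} (hu : ContinuousOn u (Icc (t - r) t))
    (θ : Icc (-r) (0 : ℝ)) : history r u t θ = u (t + θ) := by
  rw [history, dif_pos (continuous_shift hu)]
  rfl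

theorem history_congr {u v : ℝ → X} {t : ℝ} (h : EqOn u v (Icc (t - r) t)) :
    history r u t = history r v t := by
  have : (fun θ : Icc (-r) (0 : ℝ) => u (t + θ)) = fun θ : Icc (-r) (0 : ℝ) => v (t + θ) :=
    funext fun θ => h ⟨by linarith [θ.2.1], by linarith [θ.2.2]⟩
  by_cases hu : Continuous fun θ : Icc (-r) (0 : ℝ) => u (t + θ)
  · rw [history, history, dif_pos hu, dif_pos (this ▸ hu)]
    ext θ
    exact congrFun this θ
  · rw [history, history, dif_neg hu, dif_neg (this ▸ hu)]

theorem continuous_history {u : ℝ → X} (hu : Continuous u) : Continuous (history r u) := by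
  have h : Continuous (Function.uncurry fun (t : ℝ) (θ : Icc (-r) (0 : ℝ)) => u (t + θ)) :=
    hu.comp (by fun_prop)
  convert! (ContinuousMap.curry ⟨_, h⟩).continuous using 1
  funext t
  ext θ
  rw [history_apply hu.continuousOn]
  rfl

theorem exists_continuous_eqOn {u : ℝ → X} {c d : ℝ} (hu : ContinuousOn u (Icc c d)) :
    ∃ v : ℝ → X, Continuous v ∧ EqOn u v (Icc c d) := by
  rcases le_or_gt c d with h | h
  · exact ⟨fun t => u (projIcc c d h t), hu.comp_continuous
      (continuous_subtype_val.comp continuous_projIcc) fun t => (projIcc c d h t).2,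
      fun t ht => by simp [projIcc_of_mem h ht]⟩
  · exact ⟨0, continuous_zero, by simp [Icc_eq_empty_of_lt h]⟩

theorem continuousOn_history {u : ℝ → X} {s τ : ℝ} (hu : ContinuousOn u (Icc (s - r) τ)) :
    ContinuousOn (history r u) (Icc s τ) := by
  obtain ⟨v, hv, huv⟩ := exists_continuous_eqOn hu
  refine (continuous_history (r := r) hv).continuousOn.congr fun t ht => ?_
  exact history_congr (huv.mono (Icc_subset_Icc (by linarith [ht.1]) ht.2))

theorem norm_history_sub_le {u : ℝ → X} {t : ℝ} (hu : ContinuousOn u (Icc (t - r) t))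
    {φ : HistorySpace r X} {C : ℝ} (hC : 0 ≤ C)
    (h : ∀ θ : Icc (-r) (0 : ℝ), ‖u (t + θ) - φ θ‖ ≤ C) : ‖history r u t - φ‖ ≤ C :=
  (ContinuousMap.norm_le _ hC).2 fun θ => by
    rw [ContinuousMap.sub_apply, history_apply hu]
    exact h θ

theorem norm_history_sub_history_le {u v : ℝ → X} {t : ℝ} (hu : ContinuousOn u (Icc (t - r) t))
    (hv : ContinuousOn v (Icc (t - r) t)) {C : ℝ} (hC : 0 ≤ C)
    (h : ∀ x ∈ Icc (t - r) t, ‖u x - v x‖ ≤ C) : ‖history r u t - history r v t‖ ≤ C :=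
  norm_history_sub_le hu hC fun θ => by
    rw [history_apply hv]
    exact h _ ⟨by linarith [θ.2.1], by linarith [θ.2.2]⟩

end History

section MildSolution

variable {X : Type*} [NormedAddCommGroup X] [NormedSpace ℝ X] {r : ℝ}
  {hr : 0 < r} {T : ℝ → X →L[ℝ] X} {B : ℝ → HistorySpace r X → X} {a s τ : ℝ}
  {φ : HistorySpace r X} {u v : ℝ → X}

theorem intervalIntegrable_convolution (hT : IsC0Semigroup T) {ω : ℝ}
    (hω : ∀ t : ℝ, 0 ≤ t → ‖T t‖ ≤ Real.exp (ω * t))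
    (hB : Continuous (Function.uncurry B)) (hu : ContinuousOn u (Icc (s - r) τ)) {t : ℝ}
    (ht : t ∈ Icc s τ) :
    IntervalIntegrable (fun σ => T (t - σ) (B σ (history r u σ))) volume s t := by
  refine ContinuousOn.intervalIntegrable ?_
  rw [uIcc_of_le ht.1]
  have h1 : ContinuousOn (fun σ => B σ (history r u σ)) (Icc s t) :=
    hB.comp_continuousOn (continuousOn_id.prodMk
      ((continuousOn_history hu).mono (Icc_subset_Icc_right ht.2)))
  refine ((hT.continuous_max hω).comp_continuousOn
    ((by fun_prop : ContinuousOn (fun σ => t - σ) (Icc s t)).prodMk h1)).congr fun σ hσ => ?_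
  simp [max_eq_left (sub_nonneg.2 hσ.2)]

theorem semigroup_apply_variation_of_constants [CompleteSpace X]
    (hT : IsC0Semigroup T) {f : ℝ → X} {t : ℝ}
    (has : a ≤ s) (hst : s ≤ t)
    (hf : IntervalIntegrable (fun σ => T (s - σ) (f σ)) volume a s) (x : X) :
    T (t - s) (T (s - a) x + ∫ σ in a..s, T (s - σ) (f σ)) =
      T (t - a) x + ∫ σ in a..s, T (t - σ) (f σ) := by
  have hcomp : ∀ σ, σ ≤ s → ∀ y, T (t - s) (T (s - σ) y) = T (t - σ) y := fun σ hσ y => by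
    have h := hT.map_add (t - s) (s - σ) (sub_nonneg.2 hst) (sub_nonneg.2 hσ)
    rw [sub_add_sub_cancel] at h
    rw [h]
    rfl
  rw [map_add, hcomp a has, ← ContinuousLinearMap.intervalIntegral_comp_comm _ hf]
  congr 1
  refine intervalIntegral.integral_congr fun σ hσ => ?_
  rw [uIcc_of_le has] at hσ
  exact hcomp σ hσ.2 _

theorem IsMildSolutionOn.congr (h : IsMildSolutionOn hr T B a φ τ u) (haτ : a ≤ τ)
    (huv : EqOn u v (Icc (a - r) τ)) : IsMildSolutionOn hr T B a φ τ v := by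
  have hhist : ∀ t ∈ Icc a τ, history r u t = history r v t := fun t ht =>
    history_congr (huv.mono (Icc_subset_Icc (by linarith [ht.1]) ht.2))
  have hEq : ∀ t ∈ Icc a τ, EqOn (fun σ => T (t - σ) (B σ (history r u σ)))
      (fun σ => T (t - σ) (B σ (history r v σ))) (uIcc a t) := fun t ht σ hσ => by
    rw [uIcc_of_le ht.1] at hσ
    simp only [hhist σ ⟨hσ.1, hσ.2.trans ht.2⟩]
  refine ⟨h.continuousOn.congr fun x hx => (huv hx).symm, fun θ => ?_, fun t ht => ?_,
    fun t ht => ?_⟩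
  · rw [← huv ⟨by linarith [θ.2.1], by linarith [θ.2.2]⟩, h.initial]
  · exact (h.integrable t ht).congr fun σ hσ => hEq t ht (uIoc_subset_uIcc hσ)
  · rw [← huv ⟨by linarith [ht.1], ht.2⟩, h.eq_integral t ht,
      intervalIntegral.integral_congr (hEq t ht)]

theorem IsMildSolutionOn.mono (h : IsMildSolutionOn hr T B a φ τ u) (hs : s ≤ τ) :
    IsMildSolutionOn hr T B a φ s u :=
  ⟨h.continuousOn.mono (Icc_subset_Icc_right hs), h.initial,
    fun t ht => h.integrable t ⟨ht.1, ht.2.trans hs⟩,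
    fun t ht => h.eq_integral t ⟨ht.1, ht.2.trans hs⟩⟩

theorem IsMildSolutionOn.continuousOn_window (h : IsMildSolutionOn hr T B a φ τ u) {t : ℝ}
    (ht : t ∈ Icc a τ) : ContinuousOn u (Icc (t - r) t) :=
  h.continuousOn.mono (Icc_subset_Icc (by linarith [ht.1]) ht.2)

theorem IsMildSolutionOn.history_zeroPt (h : IsMildSolutionOn hr T B a φ τ u) {t : ℝ}
    (ht : t ∈ Icc a τ) : history r u t (zeroPt hr) = u t := by
  rw [history_apply (h.continuousOn_window ht)]
  simp [zeroPt]

/-- Restarting a mild solution at a later time. -/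
theorem IsMildSolutionOn.restart [CompleteSpace X]
    (hT : IsC0Semigroup T) (h : IsMildSolutionOn hr T B a φ τ u)
    (has : a ≤ s) (hsτ : s ≤ τ) : IsMildSolutionOn hr T B s (history r u s) τ u := by
  have hint : ∀ t ∈ Icc s τ,
      IntervalIntegrable (fun σ => T (t - σ) (B σ (history r u σ))) volume s t := fun t ht =>
    (h.integrable t ⟨has.trans ht.1, ht.2⟩).mono_set (by
      rw [uIcc_of_le ht.1, uIcc_of_le (has.trans ht.1)]
      exact Icc_subset_Icc_left has)
  refine ⟨h.continuousOn.mono (Icc_subset_Icc_left (by linarith)), fun θ => ?_, hint,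
    fun t ht => ?_⟩
  · rw [history_apply (h.continuousOn_window ⟨has, hsτ⟩)]
  · have h1 := (h.integrable t ⟨has.trans ht.1, ht.2⟩).mono_set (c := a) (d := s) (by
      rw [uIcc_of_le has, uIcc_of_le (has.trans ht.1)]
      exact Icc_subset_Icc_right ht.1)
    rw [h.history_zeroPt ⟨has, hsτ⟩, h.eq_integral s ⟨has, hsτ⟩,
      semigroup_apply_variation_of_constants hT has ht.1 (h.integrable s ⟨has, hsτ⟩),
      h.eq_integral t ⟨has.trans ht.1, ht.2⟩, add_assoc,
      intervalIntegral.integral_add_adjacent_intervals h1 (hint t ht)]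

/-- Continuing a mild solution by a mild solution that starts from its final history. -/
theorem IsMildSolutionOn.concat [CompleteSpace X]
    (hT : IsC0Semigroup T) {ω : ℝ}
    (hω : ∀ t : ℝ, 0 ≤ t → ‖T t‖ ≤ Real.exp (ω * t)) (hB : Continuous (Function.uncurry B))
    (hu : IsMildSolutionOn hr T B a φ s u) (has : a ≤ s)
    (hv : IsMildSolutionOn hr T B s (history r u s) τ v) (hsτ : s ≤ τ) :
    ∃ w, IsMildSolutionOn hr T B a φ τ w ∧ EqOn w u (Icc (a - r) s) ∧
      EqOn w v (Icc (s - r) τ) := by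
  set w : ℝ → X := fun t => if t ≤ s then u t else v t with hw
  have hwu : EqOn w u (Icc (a - r) s) := fun t ht => if_pos ht.2
  have hwv : EqOn w v (Icc (s - r) τ) := fun t ht => by
    simp only [hw]
    split_ifs with hts
    · have h1 := hv.initial ⟨t - s, by linarith [ht.1], by linarith⟩
      rw [history_apply (hu.continuousOn_window ⟨has, le_rfl⟩)] at h1
      simpa using h1.symm
    · rfl
  have hwc : ContinuousOn w (Icc (a - r) τ) := by
    have h1 : ContinuousOn w (Icc (a - r) s ∪ Icc (s - r) τ) := by
      have h2 : ContinuousOn w (Icc (a - r) s ∪ Icc s τ) :=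
        (hu.continuousOn.congr hwu).union_of_isClosed
          ((hv.continuousOn.congr hwv).mono (Icc_subset_Icc_left (by linarith)))
          isClosed_Icc isClosed_Icc
      refine h2.mono ?_
      intro t ht
      rcases le_or_gt t s with hts | hts
      · rcases ht with ht | ht
        · exact Or.inl ht
        · exact Or.inl ⟨by linarith [ht.1], hts⟩
      · rcases ht with ht | ht
        · exact Or.inl ht
        · exact Or.inr ⟨hts.le, ht.2⟩
    refine h1.mono fun t ht => ?_
    rcases le_or_gt t s with hts | hts
    · exact Or.inl ⟨ht.1, hts⟩
    · exact Or.inr ⟨by linarith, ht.2⟩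
  refine ⟨w, ⟨hwc, fun θ => ?_, fun t ht => intervalIntegrable_convolution hT hω hB hwc ht,
    fun t ht => ?_⟩, hwu, hwv⟩
  · rw [hwu ⟨by linarith [θ.2.1], by linarith [θ.2.2]⟩, hu.initial]
  · rcases le_or_gt t s with hts | hts
    · exact ((hu.congr has hwu.symm).eq_integral t ⟨ht.1, hts⟩)
    · have hw1 := hu.congr has hwu.symm
      have hw2 := hv.congr hsτ hwv.symm
      have h1 := intervalIntegrable_convolution hT hω hB hwc ht
      have h2 := h1.mono_set (c := a) (d := s) (by
        rw [uIcc_of_le has, uIcc_of_le ht.1]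
        exact Icc_subset_Icc_right hts.le)
      rw [hw2.eq_integral t ⟨hts.le, ht.2⟩, hu.history_zeroPt ⟨has, le_rfl⟩,
        ← hwu ⟨by linarith, le_rfl⟩, hw1.eq_integral s ⟨has, le_rfl⟩,
        semigroup_apply_variation_of_constants hT has hts.le (hw1.integrable s ⟨has, le_rfl⟩),
        add_assoc, intervalIntegral.integral_add_adjacent_intervals h2
          (hw2.integrable t ⟨hts.le, ht.2⟩)]

end MildSolution

/-! ### Local estimates and local existence -/

section Estimate

variable {X : Type*} [NormedAddCommGroup X] [NormedSpace ℝ X] {r : ℝ}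
  {hr : 0 < r} {T : ℝ → X →L[ℝ] X} {B : ℝ → HistorySpace r X → X} {s τ : ℝ}

/-- Two mild solutions `u₁`, `u₂` on a short interval `[s, τ]` are as close as their initial
histories and the values of `B` near the history of `u₂` permit. As `B` is only Lipschitz for
histories with a common past, `u₁` is compared with the function `w` that has the past of `u₁` and
the increments of `u₂` on `[s, τ]`. -/
theorem IsMildSolutionOn.norm_sub_le {K L δ ε β : ℝ} {φ₀ ψ₁ ψ₂ : HistorySpace r X}
    {u₁ u₂ : ℝ → X} (h₁ : IsMildSolutionOn hr T B s ψ₁ τ u₁)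
    (h₂ : IsMildSolutionOn hr T B s ψ₂ τ u₂) (hsτ : s ≤ τ)
    (hK1 : 1 ≤ K) (hK : ∀ σ ∈ Icc 0 (τ - s), ‖T σ‖ ≤ K) (hL : 0 ≤ L)
    (hLip : ∀ t, s < t → t ≤ τ → ∀ φ ψ : HistorySpace r X, ‖φ - φ₀‖ ≤ δ → ‖ψ - φ₀‖ ≤ δ →
      (∀ θ : Icc (-r) (0 : ℝ), (θ : ℝ) ≤ s - t → φ θ = ψ θ) → ‖B t φ - B t ψ‖ ≤ L * ‖φ - ψ‖)
    (hτ : τ - s ≤ 1) (hsmall : K * L * (τ - s) ≤ 1 / 4) (hε : ‖ψ₁ - ψ₂‖ ≤ ε)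
    (hu₁ : ∀ t ∈ Icc s τ, ‖history r u₁ t - φ₀‖ ≤ δ)
    (hu₂ : ∀ t ∈ Icc s τ, ‖history r u₂ t - φ₀‖ + ε ≤ δ)
    (hβ : ∀ t ∈ Icc s τ, ∀ χ : HistorySpace r X, ‖χ - history r u₂ t‖ ≤ ε →
      ‖B t χ - B t (history r u₂ t)‖ ≤ β) :
    ∀ t ∈ Icc s τ, ‖u₁ t - u₂ t‖ ≤ 2 * K * (2 * ε + β) := by
  have hε0 : 0 ≤ ε := (norm_nonneg _).trans hε
  have hs : s ∈ Icc s τ := left_mem_Icc.2 hsτ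
  have hβ0 : 0 ≤ β := by simpa [hε0] using hβ s hs (history r u₂ s)
  have hdc : ContinuousOn (fun x => u₁ x - u₂ x) (Icc (s - r) τ) :=
    h₁.continuousOn.sub h₂.continuousOn
  have hpast : ∀ x ∈ Icc (s - r) s, ‖u₁ x - u₂ x‖ ≤ ε := fun x hx => by
    have e1 := h₁.initial ⟨x - s, by linarith [hx.1], by linarith [hx.2]⟩
    have e2 := h₂.initial ⟨x - s, by linarith [hx.1], by linarith [hx.2]⟩
    simp only [add_sub_cancel] at e1 e2
    rw [e1, e2]
    exact ((ψ₁ - ψ₂).norm_coe_le_norm _).trans hε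
  obtain ⟨m, hm, hmax⟩ := isCompact_Icc.exists_isMaxOn ⟨s, hs⟩
    (hdc.mono (Icc_subset_Icc_left (by linarith))).norm
  set N := ‖u₁ m - u₂ m‖ with hN
  have hN0 : 0 ≤ N := norm_nonneg _
  have hmax' : ∀ x ∈ Icc s τ, ‖u₁ x - u₂ x‖ ≤ N := fun x hx => hmax hx
  set w : ℝ → X := fun x => u₂ x + (u₁ (min x s) - u₂ (min x s)) with hw
  have hwc : ContinuousOn w (Icc (s - r) τ) := by
    refine h₂.continuousOn.add (hdc.comp (by fun_prop) fun x hx => ?_)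
    exact ⟨le_min hx.1 (by linarith), (min_le_right _ _).trans hsτ⟩
  have hwin : ∀ t ∈ Icc s τ, Icc (t - r) t ⊆ Icc (s - r) τ := fun t ht =>
    Icc_subset_Icc (by linarith [ht.1]) ht.2
  have hw₂ : ∀ t ∈ Icc s τ, ‖history r w t - history r u₂ t‖ ≤ ε := fun t ht => by
    refine norm_history_sub_history_le (hwc.mono (hwin t ht)) (h₂.continuousOn_window ht) hε0
      fun x hx => ?_
    simp only [hw, add_sub_cancel_left]
    exact hpast _ ⟨le_min (by linarith [hx.1, ht.1]) (by linarith), min_le_right _ _⟩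
  have hw₁ : ∀ t ∈ Icc s τ, ‖history r u₁ t - history r w t‖ ≤ N + ε := fun t ht => by
    refine norm_history_sub_history_le (h₁.continuousOn_window ht) (hwc.mono (hwin t ht))
      (by positivity) fun x hx => ?_
    simp only [hw]
    rcases le_total x s with hxs | hxs
    · simp only [min_eq_left hxs, add_sub_cancel, sub_self, norm_zero]
      positivity
    · rw [min_eq_right hxs, ← sub_sub]
      exact (_root_.norm_sub_le _ _).trans (add_le_add (hmax' x ⟨hxs, hx.2.trans ht.2⟩)
        (hpast s ⟨by linarith, le_rfl⟩))
  have hBd : ∀ t, s < t → t ≤ τ →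
      ‖B t (history r u₁ t) - B t (history r u₂ t)‖ ≤ L * (N + ε) + β := fun t hst htτ => by
    have ht : t ∈ Icc s τ := ⟨hst.le, htτ⟩
    have e1 : ‖history r w t - φ₀‖ ≤ δ := by
      have := norm_sub_le_norm_sub_add_norm_sub (history r w t) (history r u₂ t) φ₀
      linarith [hw₂ t ht, hu₂ t ht]
    have e2 := hLip t hst htτ _ _ (hu₁ t ht) e1 fun θ hθ => by
      rw [history_apply (h₁.continuousOn_window ht), history_apply (hwc.mono (hwin t ht))]
      simp only [hw]
      rw [min_eq_left (by linarith)]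
      abel
    have e3 := hβ t ht _ (hw₂ t ht)
    have e4 := hw₁ t ht
    calc _ ≤ ‖B t (history r u₁ t) - B t (history r w t)‖ +
          ‖B t (history r w t) - B t (history r u₂ t)‖ := norm_sub_le_norm_sub_add_norm_sub _ _ _
      _ ≤ L * (N + ε) + β := add_le_add (e2.trans (by gcongr)) e3
  have hkey : ∀ t ∈ Icc s τ, ‖u₁ t - u₂ t‖ ≤ K * ε + K * (L * (N + ε) + β) * (τ - s) := by
    intro t ht
    have e1 : u₁ t - u₂ t = T (t - s) (ψ₁ (zeroPt hr) - ψ₂ (zeroPt hr)) +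
        ∫ σ in s..t, (T (t - σ) (B σ (history r u₁ σ)) - T (t - σ) (B σ (history r u₂ σ))) := by
      rw [intervalIntegral.integral_sub (h₁.integrable t ht) (h₂.integrable t ht),
        h₁.eq_integral t ht, h₂.eq_integral t ht, map_sub]
      abel
    have hKt : ∀ σ, s ≤ σ → σ ≤ t → ‖T (t - σ)‖ ≤ K := fun σ hσ hσt =>
      hK _ ⟨sub_nonneg.2 hσt, by linarith [ht.2]⟩
    rw [e1]
    refine (norm_add_le _ _).trans (add_le_add ?_ ?_)
    · refine (T _).le_of_opNorm_le_of_le (hKt s le_rfl ht.1) ?_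
      exact ((ψ₁ - ψ₂).norm_coe_le_norm _).trans hε
    · have e2 := intervalIntegral.norm_integral_le_of_norm_le_const (a := s) (b := t)
        (f := fun σ => T (t - σ) (B σ (history r u₁ σ)) - T (t - σ) (B σ (history r u₂ σ)))
        (C := K * (L * (N + ε) + β)) fun σ hσ => by
          rw [uIoc_of_le ht.1] at hσ
          rw [← map_sub]
          exact (T _).le_of_opNorm_le_of_le (hKt σ hσ.1.le hσ.2) (hBd σ hσ.1 (hσ.2.trans ht.2))
      refine e2.trans ?_
      rw [abs_of_nonneg (sub_nonneg.2 ht.1)]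
      gcongr
      exact ht.2
  have hfin : N ≤ 2 * K * (2 * ε + β) := by
    have e1 := hkey m hm
    have e2 : K * β * (τ - s) ≤ K * β * 1 := by gcongr
    have e3 : K * L * (τ - s) * (N + ε) ≤ 1 / 4 * (N + ε) := by gcongr
    have e4 : ε ≤ K * ε := le_mul_of_one_le_left hε0 hK1
    have e5 : 0 ≤ K * β := by positivity
    nlinarith
  exact fun t ht => (hmax' t ht).trans hfin

end Estimate

section LocalExistence

variable {X : Type*} [NormedAddCommGroup X] {r : ℝ} {s τ : ℝ}

/-- The function that equals `ψ` (shifted to `[s - r, s]`) before time `s` and then has the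
increments of `x`. Gluing increments keeps it continuous when `x` does not start from `ψ 0`. -/
noncomputable def glueHistory (hr : 0 < r) (hsτ : s ≤ τ) (ψ : HistorySpace r X)
    (x : C(Icc s τ, X)) (t : ℝ) : X :=
  ψ (projIcc (-r) 0 (neg_nonpos.2 hr.le) (t - s)) +
    (x (projIcc s τ hsτ t) - x ⟨s, left_mem_Icc.2 hsτ⟩)

variable (hr : 0 < r) (hsτ : s ≤ τ) (ψ : HistorySpace r X) (x y : C(Icc s τ, X))

theorem continuous_glueHistory : Continuous (glueHistory hr hsτ ψ x) := by
  have h1 : Continuous fun t : ℝ => projIcc (-r) 0 (neg_nonpos.2 hr.le) (t - s) :=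
    continuous_projIcc.comp (by fun_prop)
  have h2 : Continuous fun t : ℝ => projIcc s τ hsτ t := continuous_projIcc
  exact (ψ.continuous.comp h1).add ((x.continuous.comp h2).sub continuous_const)

theorem glueHistory_of_le {t : ℝ} (ht : t ≤ s) :
    glueHistory hr hsτ ψ x t = ψ (projIcc (-r) 0 (neg_nonpos.2 hr.le) (t - s)) := by
  rw [glueHistory, projIcc_of_le_left hsτ ht, sub_self, add_zero]

theorem glueHistory_of_ge {t : ℝ} (ht : s ≤ t) :
    glueHistory hr hsτ ψ x t =
      ψ (zeroPt hr) + (x (projIcc s τ hsτ t) - x ⟨s, left_mem_Icc.2 hsτ⟩) := by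
  rw [glueHistory, projIcc_of_right_le (neg_nonpos.2 hr.le) (sub_nonneg.2 ht)]
  rfl

theorem norm_glueHistory_sub_le (t : ℝ) :
    ‖glueHistory hr hsτ ψ x t - glueHistory hr hsτ ψ y t‖ ≤ 2 * ‖x - y‖ := by
  have h : glueHistory hr hsτ ψ x t - glueHistory hr hsτ ψ y t =
      (x - y) (projIcc s τ hsτ t) - (x - y) ⟨s, left_mem_Icc.2 hsτ⟩ := by
    simp only [glueHistory, ContinuousMap.sub_apply]
    abel
  rw [h, two_mul]
  exact (norm_sub_le _ _).trans (add_le_add ((x - y).norm_coe_le_norm _)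
    ((x - y).norm_coe_le_norm _))

theorem norm_history_glueHistory_sub_le {φ₀ : HistorySpace r X} {d κ : ℝ}
    (hφ₀ : ∀ θ θ' : Icc (-r) (0 : ℝ), |(θ : ℝ) - θ'| ≤ d → ‖φ₀ θ - φ₀ θ'‖ ≤ κ)
    (hψ : ‖ψ - φ₀‖ ≤ κ) (hx : ∀ t, ‖x t - φ₀ (zeroPt hr)‖ ≤ κ) {t : ℝ} (ht : s ≤ t)
    (htd : t - s ≤ d) : ‖history r (glueHistory hr hsτ ψ x) t - φ₀‖ ≤ 4 * κ := by
  have hκ : 0 ≤ κ := (norm_nonneg _).trans hψ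
  refine norm_history_sub_le (continuous_glueHistory hr hsτ ψ x).continuousOn (by positivity)
    fun θ => ?_
  have hψ' : ∀ θ', ‖ψ θ' - φ₀ θ'‖ ≤ κ := fun θ' => ((ψ - φ₀).norm_coe_le_norm θ').trans hψ
  rcases le_total (t + θ) s with h | h
  · have hmem : t + θ - s ∈ Icc (-r) (0 : ℝ) := ⟨by linarith [θ.2.1], by linarith⟩
    rw [glueHistory_of_le hr hsτ ψ x h, projIcc_of_mem _ hmem]
    have e1 := hφ₀ ⟨t + θ - s, hmem⟩ θ (by
      rw [abs_of_nonneg] <;> simp only <;> linarith)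
    have e2 := norm_sub_le_norm_sub_add_norm_sub (ψ ⟨t + θ - s, hmem⟩) (φ₀ ⟨t + θ - s, hmem⟩)
      (φ₀ θ)
    linarith [hψ' ⟨t + θ - s, hmem⟩]
  · rw [glueHistory_of_ge hr hsτ ψ x h]
    have e1 := hφ₀ (zeroPt hr) θ (by
      rw [zeroPt, zero_sub, abs_neg, abs_of_nonpos θ.2.2]
      linarith)
    have e2 : ψ (zeroPt hr) + (x (projIcc s τ hsτ (t + θ)) - x ⟨s, left_mem_Icc.2 hsτ⟩) - φ₀ θ =
        (ψ (zeroPt hr) - φ₀ (zeroPt hr)) + (x (projIcc s τ hsτ (t + θ)) - φ₀ (zeroPt hr)) -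
          (x ⟨s, left_mem_Icc.2 hsτ⟩ - φ₀ (zeroPt hr)) + (φ₀ (zeroPt hr) - φ₀ θ) := by abel
    rw [e2]
    refine (norm_add_le _ _).trans ?_
    have e3 := norm_sub_le ((ψ (zeroPt hr) - φ₀ (zeroPt hr)) +
      (x (projIcc s τ hsτ (t + θ)) - φ₀ (zeroPt hr))) (x ⟨s, left_mem_Icc.2 hsτ⟩ - φ₀ (zeroPt hr))
    have e4 := norm_add_le (ψ (zeroPt hr) - φ₀ (zeroPt hr))
      (x (projIcc s τ hsτ (t + θ)) - φ₀ (zeroPt hr))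
    linarith [hψ' (zeroPt hr), hx (projIcc s τ hsτ (t + θ)), hx ⟨s, left_mem_Icc.2 hsτ⟩]

variable [NormedSpace ℝ X] [CompleteSpace X] {hr hsτ ψ}
  {T : ℝ → X →L[ℝ] X} {B : ℝ → HistorySpace r X → X}

/-- Existence on a prescribed short interval `[s, τ]`, by the contraction principle in a ball of
`C([s, τ]; X)`. -/
theorem exists_isMildSolutionOn_of_small (hT : IsC0Semigroup T) {ω : ℝ}
    (hω : ∀ t : ℝ, 0 ≤ t → ‖T t‖ ≤ Real.exp (ω * t)) (hB : Continuous (Function.uncurry B))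
    (hsτ : s ≤ τ) {φ₀ : HistorySpace r X} {κ K L M : ℝ}
    (hφ₀ : ∀ θ θ' : Icc (-r) (0 : ℝ), |(θ : ℝ) - θ'| ≤ τ - s → ‖φ₀ θ - φ₀ θ'‖ ≤ κ)
    (hψ : ‖ψ - φ₀‖ ≤ κ) (hL : 0 ≤ L) (hK : ∀ σ ∈ Icc 0 (τ - s), ‖T σ‖ ≤ K)
    (hLip : ∀ t, s < t → t ≤ τ → ∀ φ ψ : HistorySpace r X, ‖φ - φ₀‖ ≤ 4 * κ → ‖ψ - φ₀‖ ≤ 4 * κ →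
      (∀ θ : Icc (-r) (0 : ℝ), (θ : ℝ) ≤ s - t → φ θ = ψ θ) → ‖B t φ - B t ψ‖ ≤ L * ‖φ - ψ‖)
    (hM : ∀ t ∈ Icc s τ, ∀ φ : HistorySpace r X, ‖φ - φ₀‖ ≤ 4 * κ → ‖B t φ‖ ≤ M)
    (hsmall : K * L * (τ - s) ≤ 1 / 4) (hball : K * ‖ψ - φ₀‖ + K * M * (τ - s) ≤ κ / 2)
    (hT₀ : ∀ σ ∈ Icc 0 (τ - s), ‖T σ (φ₀ (zeroPt hr)) - φ₀ (zeroPt hr)‖ ≤ κ / 2) :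
    ∃ v, IsMildSolutionOn hr T B s ψ τ v ∧
      ∀ t ∈ Icc s τ, ‖history r v t - φ₀‖ ≤ 4 * κ := by
  have hκ : 0 ≤ κ := (norm_nonneg _).trans hψ
  have hK0 : 0 ≤ K := (norm_nonneg _).trans (hK 0 ⟨le_rfl, sub_nonneg.2 hsτ⟩)
  set f : C(Icc s τ, X) → ℝ → X := fun x σ => B σ (history r (glueHistory hr hsτ ψ x) σ) with hf
  have hfc : ∀ x, Continuous (f x) := fun x =>
    hB.comp (continuous_id.prodMk (continuous_history (continuous_glueHistory hr hsτ ψ x)))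
  set F : C(Icc s τ, X) → ℝ → X := fun x t => T (max (t - s) 0) (ψ (zeroPt hr)) +
    ∫ σ in s..t, T (max (t - σ) 0) (f x σ) with hF
  have hFc : ∀ x, Continuous (F x) := fun x =>
    ((hT.continuous_max hω).comp
      ((by fun_prop : Continuous fun t : ℝ => t - s).prodMk continuous_const)).add
      (hT.continuous_convolution hω (hfc x) s)
  set Φ : C(Icc s τ, X) → C(Icc s τ, X) := fun x =>
    ⟨fun t => F x t, (hFc x).comp continuous_subtype_val⟩ with hΦ
  set E : Set C(Icc s τ, X) := {x | ∀ t, ‖x t - φ₀ (zeroPt hr)‖ ≤ κ} with hE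
  have hEclosed : IsClosed E := by
    simp only [hE, ofPred_forall]
    exact isClosed_iInter fun t => isClosed_le
      (((continuous_eval_const t).sub continuous_const).norm) continuous_const
  have hhist : ∀ x ∈ E, ∀ t ∈ Icc s τ,
      ‖history r (glueHistory hr hsτ ψ x) t - φ₀‖ ≤ 4 * κ := fun x hx t ht =>
    norm_history_glueHistory_sub_le hr hsτ ψ x hφ₀ hψ hx ht.1 (by linarith [ht.2])
  have hKt : ∀ t ∈ Icc s τ, ∀ σ ∈ Icc s t, ‖T (max (t - σ) 0)‖ ≤ K := fun t ht σ hσ => by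
    rw [max_eq_left (sub_nonneg.2 hσ.2)]
    exact hK _ ⟨sub_nonneg.2 hσ.2, by linarith [hσ.1, ht.2]⟩
  have hmaps : MapsTo Φ E E := fun x hx t => by
    have ht := t.2
    have e1 : Φ x t - φ₀ (zeroPt hr) =
        T (max ((t : ℝ) - s) 0) (ψ (zeroPt hr) - φ₀ (zeroPt hr)) +
        (∫ σ in s..t, T (max (t - σ) 0) (f x σ)) +
        (T (max ((t : ℝ) - s) 0) (φ₀ (zeroPt hr)) - φ₀ (zeroPt hr)) := by
      simp only [hΦ, hF, ContinuousMap.coe_mk, map_sub]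
      abel
    have e2 : ‖T (max ((t : ℝ) - s) 0) (ψ (zeroPt hr) - φ₀ (zeroPt hr))‖ ≤ K * ‖ψ - φ₀‖ :=
      (T _).le_of_opNorm_le_of_le (hKt t ht s ⟨le_rfl, ht.1⟩) ((ψ - φ₀).norm_coe_le_norm _)
    have e3 : ‖∫ σ in s..t, T (max (t - σ) 0) (f x σ)‖ ≤ K * M * (τ - s) := by
      have hM0 : 0 ≤ M := (norm_nonneg _).trans (hM t ht _ (hhist x hx t ht))
      refine (intervalIntegral.norm_integral_le_of_norm_le_const (C := K * M) fun σ hσ => ?_).trans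
        ?_
      · rw [uIoc_of_le ht.1] at hσ
        exact (T _).le_of_opNorm_le_of_le (hKt t ht σ ⟨hσ.1.le, hσ.2⟩)
          (hM σ ⟨hσ.1.le, hσ.2.trans ht.2⟩ _ (hhist x hx σ ⟨hσ.1.le, hσ.2.trans ht.2⟩))
      · rw [abs_of_nonneg (sub_nonneg.2 ht.1)]
        gcongr
        exact ht.2
    have e4 : ‖T (max ((t : ℝ) - s) 0) (φ₀ (zeroPt hr)) - φ₀ (zeroPt hr)‖ ≤ κ / 2 := by
      rw [max_eq_left (sub_nonneg.2 ht.1)]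
      exact hT₀ _ ⟨sub_nonneg.2 ht.1, by linarith [ht.2]⟩
    rw [e1]
    have e5 := norm_add₃_le
      (a := T (max ((t : ℝ) - s) 0) (ψ (zeroPt hr) - φ₀ (zeroPt hr)))
      (b := ∫ σ in s..t, T (max (t - σ) 0) (f x σ))
      (c := T (max ((t : ℝ) - s) 0) (φ₀ (zeroPt hr)) - φ₀ (zeroPt hr))
    linarith
  have hcontr : ContractingWith (1 / 2) (hmaps.restrict Φ E E) := by
    refine ⟨by rw [← NNReal.coe_lt_coe]; norm_num, LipschitzWith.of_dist_le_mul ?_⟩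
    rintro ⟨x, hx⟩ ⟨y, hy⟩
    change dist (Φ x) (Φ y) ≤ ((1 / 2 : NNReal) : ℝ) * dist x y
    rw [dist_eq_norm, dist_eq_norm, ContinuousMap.norm_le _ (by positivity)]
    intro t
    have ht := t.2
    have e1 : (Φ x - Φ y) t =
        ∫ σ in s..t, (T (max (t - σ) 0) (f x σ) - T (max (t - σ) 0) (f y σ)) := by
      have hint : ∀ x, IntervalIntegrable (fun σ => T (max ((t : ℝ) - σ) 0) (f x σ)) volume s t :=
        fun x => ((hT.continuous_max hω).comp ((by fun_prop : Continuous fun σ : ℝ =>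
          (t : ℝ) - σ).prodMk (hfc x))).intervalIntegrable _ _
      rw [intervalIntegral.integral_sub (hint x) (hint y)]
      simp only [hΦ, hF, ContinuousMap.sub_apply, ContinuousMap.coe_mk]
      abel
    rw [e1]
    refine (intervalIntegral.norm_integral_le_of_norm_le_const
      (C := K * (L * (2 * ‖x - y‖))) fun σ hσ => ?_).trans ?_
    · rw [uIoc_of_le ht.1] at hσ
      have hσ' : σ ∈ Icc s τ := ⟨hσ.1.le, hσ.2.trans ht.2⟩
      rw [← map_sub]
      refine (T _).le_of_opNorm_le_of_le (hKt t ht σ ⟨hσ.1.le, hσ.2⟩) ?_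
      refine (hLip σ hσ.1 hσ'.2 _ _ (hhist x hx σ hσ') (hhist y hy σ hσ') fun θ hθ => ?_).trans ?_
      · rw [history_apply (continuous_glueHistory hr hsτ ψ x).continuousOn,
          history_apply (continuous_glueHistory hr hsτ ψ y).continuousOn,
          glueHistory_of_le hr hsτ ψ x (by linarith), glueHistory_of_le hr hsτ ψ y (by linarith)]
      · gcongr
        exact norm_history_sub_history_le (continuous_glueHistory hr hsτ ψ x).continuousOn
          (continuous_glueHistory hr hsτ ψ y).continuousOn (by positivity) fun z _ =>
          norm_glueHistory_sub_le hr hsτ ψ x y z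
    · rw [abs_of_nonneg (sub_nonneg.2 ht.1)]
      have e2 : K * (L * (2 * ‖x - y‖)) * (t - s) ≤ K * (L * (2 * ‖x - y‖)) * (τ - s) := by
        gcongr
        exact ht.2
      have e3 : K * L * (τ - s) * (2 * ‖x - y‖) ≤ 1 / 4 * (2 * ‖x - y‖) := by gcongr
      refine e2.trans ?_
      push_cast
      linarith
  have hconst : ContinuousMap.const _ (φ₀ (zeroPt hr)) ∈ E := fun t => by
    simpa using hκ
  obtain ⟨x, hxE, hfix, -⟩ := hcontr.exists_fixedPoint' hEclosed.isComplete hmaps hconst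
    (edist_ne_top _ _)
  have hxF : ∀ t (ht : t ∈ Icc s τ), x ⟨t, ht⟩ = F x t := fun t ht =>
    (DFunLike.congr_fun hfix ⟨t, ht⟩).symm
  have hxs : x ⟨s, left_mem_Icc.2 hsτ⟩ = ψ (zeroPt hr) := by
    rw [hxF s (left_mem_Icc.2 hsτ)]
    simp [hF, hT.map_zero]
  refine ⟨glueHistory hr hsτ ψ x, ⟨(continuous_glueHistory hr hsτ ψ x).continuousOn, fun θ => ?_,
    fun t ht => intervalIntegrable_convolution hT hω hB
      (continuous_glueHistory hr hsτ ψ x).continuousOn ht, fun t ht => ?_⟩, hhist x hxE⟩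
  · rw [glueHistory_of_le hr hsτ ψ x (by linarith [θ.2.2]), add_sub_cancel_left, projIcc_val]
  · rw [glueHistory_of_ge hr hsτ ψ x ht.1, hxs, add_sub_cancel, projIcc_of_mem hsτ ht, hxF t ht]
    simp only [hF]
    rw [max_eq_left (sub_nonneg.2 ht.1)]
    congr 1
    refine intervalIntegral.integral_congr fun σ hσ => ?_
    rw [uIcc_of_le ht.1] at hσ
    simp only [max_eq_left (sub_nonneg.2 hσ.2), hf]

end LocalExistence

/-! ### Uniqueness, maximal solutions and continuous dependence -/

section Local

variable {X : Type*} [NormedAddCommGroup X] [NormedSpace ℝ X] {r : ℝ}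
  {hr : 0 < r} {T : ℝ → X →L[ℝ] X} {B : ℝ → HistorySpace r X → X} {a : ℝ}

/-- The local well-posedness data near `(t₀, φ₀)`: a length of existence `δ` that is uniform in the
initial time `s ≤ t₀` and the initial history near `(t₀, φ₀)`, and constants for which the estimate
`IsMildSolutionOn.norm_sub_le` applies on all of `[t₀ - δ, t₀ + δ]`. -/
theorem exists_uniform_local_isMildSolutionOn [CompleteSpace X]
    (hr : 0 < r) (hT : IsC0Semigroup T) {ω : ℝ}
    (hω : ∀ t : ℝ, 0 ≤ t → ‖T t‖ ≤ Real.exp (ω * t)) (hB : Continuous (Function.uncurry B))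
    (hLip : LipschitzForCommonPast a B) {t₀ : ℝ} (ht₀ : a ≤ t₀) (φ₀ : HistorySpace r X) :
    ∃ δ > 0, ∃ ρ > 0, ∃ L ≥ 0, ∃ K ≥ 1,
      (∀ s t, a ≤ s → t₀ - δ ≤ s → s < t → t ≤ t₀ + δ → ∀ φ ψ : HistorySpace r X,
        ‖φ - φ₀‖ ≤ ρ → ‖ψ - φ₀‖ ≤ ρ → (∀ θ : Icc (-r) (0 : ℝ), (θ : ℝ) ≤ s - t → φ θ = ψ θ) →
          ‖B t φ - B t ψ‖ ≤ L * ‖φ - ψ‖) ∧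
      (∀ σ ∈ Icc 0 (2 * δ), ‖T σ‖ ≤ K) ∧ K * L * (2 * δ) ≤ 1 / 4 ∧ 2 * δ ≤ 1 ∧
      ∀ s, a ≤ s → t₀ - δ ≤ s → s ≤ t₀ → ∀ ψ : HistorySpace r X, ‖ψ - φ₀‖ ≤ δ →
        ∃ v, IsMildSolutionOn hr T B s ψ (t₀ + δ) v ∧
          ∀ t ∈ Icc s (t₀ + δ), ‖history r v t - φ₀‖ ≤ ρ / 2 := by
  obtain ⟨δ₀, hδ₀, L, hL, hL'⟩ := hLip t₀ ht₀ φ₀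
  set M := ‖B t₀ φ₀‖ + 1 with hM
  have hM0 : 0 < M := by positivity
  obtain ⟨ε, hε, hBε⟩ := Metric.eventually_nhds_iff.1
    ((hB.norm.tendsto (t₀, φ₀)).eventually_lt_const (lt_add_one ‖B t₀ φ₀‖))
  set K := Real.exp (|ω| * 1) with hK
  have hK1 : 1 ≤ K := Real.one_le_exp (by positivity)
  set ρ := min δ₀ (ε / 2) with hρ
  have hρ0 : 0 < ρ := by positivity
  -- Histories of functions in the ball of radius `κ` stay within `4 * κ = ρ / 2` of `φ₀`, which
  -- leaves room within `ρ` for comparison functions.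
  set κ := ρ / 8 with hκ
  have hκ0 : 0 < κ := by positivity
  obtain ⟨d₁, hd₁, hφ₀⟩ := Metric.uniformContinuous_iff.1
    (CompactSpace.uniformContinuous_of_continuous φ₀.continuous) κ hκ0
  obtain ⟨d₂, hd₂, hT₀⟩ := Metric.tendsto_nhdsWithin_nhds.1
    (hT.tendsto_zero (φ₀ (zeroPt hr))) (κ / 2) (by positivity)
  have hsm : ∀ c : ℝ, 0 < c → ∀ᶠ δ in 𝓝[>] (0 : ℝ), δ < c := fun c hc =>
    mem_of_superset (Ioo_mem_nhdsGT hc) fun x hx => hx.2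
  have hpos : ∀ᶠ δ in 𝓝[>] (0 : ℝ), 0 < δ := self_mem_nhdsWithin
  obtain ⟨δ, hδ, h1, h2, h3, h4, h5, h6, h7, h8⟩ := (hpos.and ((hsm δ₀ hδ₀).and
    ((hsm (ε / 2) (by positivity)).and ((hsm (d₁ / 2) (by positivity)).and
    ((hsm (d₂ / 2) (by positivity)).and ((hsm (1 / 2) (by positivity)).and
    ((hsm (κ / (4 * K)) (by positivity)).and ((hsm (1 / (8 * K * (L + 1))) (by positivity)).and
    (hsm (κ / (8 * K * M)) (by positivity)))))))))).exists
  rw [lt_div_iff₀ (by positivity)] at h6 h7 h8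
  have hKσ : ∀ σ ∈ Icc 0 (2 * δ), ‖T σ‖ ≤ K := fun σ hσ =>
    norm_semigroup_le hω hσ.1 (by linarith [hσ.2])
  have hLδ : ∀ s t, a ≤ s → t₀ - δ ≤ s → s < t → t ≤ t₀ + δ → ∀ φ ψ : HistorySpace r X,
      ‖φ - φ₀‖ ≤ ρ → ‖ψ - φ₀‖ ≤ ρ → (∀ θ : Icc (-r) (0 : ℝ), (θ : ℝ) ≤ s - t → φ θ = ψ θ) →
        ‖B t φ - B t ψ‖ ≤ L * ‖φ - ψ‖ := fun s t has hs hst ht φ ψ hφ hψ hag =>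
    hL' s t has (by linarith) hst (by linarith) φ ψ (hφ.trans (min_le_left _ _))
      (hψ.trans (min_le_left _ _)) hag
  have hKL : K * L * (2 * δ) ≤ 1 / 4 := by
    have : 0 ≤ K * δ := by positivity
    nlinarith
  refine ⟨δ, hδ, ρ, hρ0, L, hL, K, hK1, hLδ, hKσ, hKL, by linarith, ?_⟩
  intro s has hs hst₀ ψ hψ
  have hτs : t₀ + δ - s ≤ 2 * δ := by linarith
  have hρκ : 4 * κ = ρ / 2 := by rw [hκ]; ring
  have hψκ : ‖ψ - φ₀‖ ≤ κ := by
    have : δ * 1 ≤ δ * K := by gcongr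
    have : 0 ≤ δ * K := by positivity
    linarith
  rw [← hρκ]
  refine exists_isMildSolutionOn_of_small hT hω hB (K := K) (L := L) (M := M) (by linarith)
    (fun θ θ' hθ => ?_) hψκ hL (fun σ hσ => hKσ σ ⟨hσ.1, hσ.2.trans hτs⟩) ?_ ?_ ?_ ?_ ?_
  · rw [← dist_eq_norm]
    refine (hφ₀ ?_).le
    rw [Subtype.dist_eq, Real.dist_eq]
    linarith
  · intro t hst ht φ ψ' hφ hψ' hag
    exact hLδ s t has hs hst ht φ ψ' (by linarith) (by linarith) hag
  · intro t ht φ hφ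
    refine (@hBε (t, φ) ?_).le
    rw [Prod.dist_eq, max_lt_iff, Real.dist_eq, dist_eq_norm]
    have : ρ ≤ ε / 2 := min_le_right _ _
    exact ⟨abs_lt.2 ⟨by linarith [ht.1], by linarith [ht.2]⟩, by linarith⟩
  · refine le_trans ?_ hKL
    gcongr
  · have e1 : K * ‖ψ - φ₀‖ ≤ K * δ := by gcongr
    have e2 : K * M * (t₀ + δ - s) ≤ K * M * (2 * δ) := by gcongr
    linarith
  · intro σ hσ
    rw [← dist_eq_norm]
    refine (hT₀ hσ.1 ?_).le
    rw [Real.dist_eq, sub_zero, abs_of_nonneg hσ.1]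
    linarith [hσ.2]

theorem IsMildSolutionOn.exists_extension [CompleteSpace X]
    (hT : IsC0Semigroup T) {ω : ℝ}
    (hω : ∀ t : ℝ, 0 ≤ t → ‖T t‖ ≤ Real.exp (ω * t)) (hB : Continuous (Function.uncurry B))
    (hLip : LipschitzForCommonPast a B) {φ : HistorySpace r X} {τ : ℝ} {u : ℝ → X} (haτ : a ≤ τ)
    (hu : IsMildSolutionOn hr T B a φ τ u) :
    ∃ τ' > τ, ∃ w, IsMildSolutionOn hr T B a φ τ' w := by
  obtain ⟨δ, hδ, _, _, _, _, _, _, _, _, _, _, hex⟩ :=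
    exists_uniform_local_isMildSolutionOn hr hT hω hB hLip haτ (history r u τ)
  obtain ⟨v, hv, -⟩ := hex τ haτ (by linarith) le_rfl (history r u τ) (by simpa using hδ.le)
  obtain ⟨w, hw, -⟩ := hu.concat hT hω hB haτ hv (by linarith)
  exact ⟨τ + δ, by linarith, w, hw⟩

/-- On the degenerate interval `[a, a]` any extension of the initial history is a mild solution. -/
theorem isMildSolutionOn_self (hr : 0 < r) (hT : IsC0Semigroup T) (φ : HistorySpace r X) :
    IsMildSolutionOn hr T B a φ a
      (fun t => φ (projIcc (-r) 0 (neg_nonpos.2 hr.le) (t - a))) := by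
  refine ⟨?_, fun θ => ?_, fun t ht => ?_, fun t ht => ?_⟩
  · have h : Continuous fun t : ℝ => projIcc (-r) 0 (neg_nonpos.2 hr.le) (t - a) :=
      continuous_projIcc.comp (by fun_prop)
    exact (φ.continuous.comp h).continuousOn
  · rw [add_sub_cancel_left, projIcc_val]
  · rw [le_antisymm ht.2 ht.1]
  · rw [le_antisymm ht.2 ht.1, projIcc_of_right_le _ (by simp)]
    simp [hT.map_zero, zeroPt]

/-- Two mild solutions with the same initial history coincide: the supremum of the times up to which
they agree can be exceeded by the local estimate, as they have a common past there. -/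
theorem IsMildSolutionOn.eqOn [CompleteSpace X] (hT : IsC0Semigroup T) {ω : ℝ}
    (hω : ∀ t : ℝ, 0 ≤ t → ‖T t‖ ≤ Real.exp (ω * t)) (hB : Continuous (Function.uncurry B))
    (hLip : LipschitzForCommonPast a B) {φ : HistorySpace r X} {τ : ℝ} {u v : ℝ → X}
    (haτ : a ≤ τ) (hu : IsMildSolutionOn hr T B a φ τ u)
    (hv : IsMildSolutionOn hr T B a φ τ v) : EqOn u v (Icc (a - r) τ) := by
  obtain ⟨u', hu'c, huu'⟩ := exists_continuous_eqOn hu.continuousOn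
  obtain ⟨v', hv'c, hvv'⟩ := exists_continuous_eqOn hv.continuousOn
  have hu' := hu.congr haτ huu'
  have hv' := hv.congr haτ hvv'
  suffices h : EqOn u' v' (Icc (a - r) τ) from fun x hx => by rw [huu' hx, h hx, hvv' hx]
  have hstart : ∀ x ∈ Icc (a - r) a, u' x = v' x := fun x hx => by
    have e1 := hu'.initial ⟨x - a, by linarith [hx.1], by linarith [hx.2]⟩
    have e2 := hv'.initial ⟨x - a, by linarith [hx.1], by linarith [hx.2]⟩
    simp only [add_sub_cancel] at e1 e2
    rw [e1, e2]
  -- The times up to which `u'` and `v'` agree, written as an intersection of closed conditions.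
  set A : Set ℝ := {t | ∀ x, 0 ≤ x → u' (max (t - x) a) = v' (max (t - x) a)} with hA
  have hAclosed : IsClosed A := by
    simp only [hA, ofPred_forall]
    exact isClosed_iInter fun x => isClosed_iInter fun _ =>
      isClosed_eq (hu'c.comp (by fun_prop)) (hv'c.comp (by fun_prop))
  have hAiff : ∀ t ∈ A, ∀ x ∈ Icc (a - r) t, u' x = v' x := fun t ht x hx => by
    rcases le_total x a with hxa | hxa
    · exact hstart x ⟨hx.1, hxa⟩
    · have := ht (t - x) (sub_nonneg.2 hx.2)
      rwa [sub_sub_cancel, max_eq_left hxa] at this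
  have haA : a ∈ A := fun x hx => by
    rw [max_eq_right (by linarith)]
    exact hstart a ⟨by linarith, le_rfl⟩
  have hsub : Icc a τ ⊆ A := by
    refine (hAclosed.inter isClosed_Icc).Icc_subset_of_forall_exists_gt haA ?_
    rintro t ⟨htA, ht⟩ y hy
    have hhist : history r v' t = history r u' t :=
      history_congr fun x hx => (hAiff t htA x ⟨by linarith [hx.1, ht.1], hx.2⟩).symm
    obtain ⟨δ, hδ, ρ, hρ, L, hL, K, hK1, hLδ, hKσ, hKL, hδ1, -⟩ :=
      exists_uniform_local_isMildSolutionOn hr hT hω hB hLip ht.1 (history r u' t)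
    have hnear : ∀ᶠ x in 𝓝 t, ‖history r u' x - history r u' t‖ < ρ ∧
        ‖history r v' x - history r u' t‖ < ρ := by
      refine (((continuous_history hu'c).sub continuous_const).norm.continuousAt.eventually_lt_const
        ?_).and (((continuous_history hv'c).sub
          continuous_const).norm.continuousAt.eventually_lt_const ?_)
      · simpa using hρ
      · simpa [hhist] using hρ
    obtain ⟨ε, hε, hball⟩ := Metric.eventually_nhds_iff.1 hnear
    set σ := min (min τ y) (t + min δ (ε / 2)) with hσ
    have htσ : t < σ :=
      lt_min (lt_min ht.2 hy) (lt_add_of_pos_right _ (lt_min hδ (by positivity)))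
    have hστ : σ ≤ τ := (min_le_left _ _).trans (min_le_left _ _)
    have hσy : σ ≤ y := (min_le_left _ _).trans (min_le_right _ _)
    have hσδ : σ ≤ t + δ :=
      (min_le_right _ _).trans (add_le_add_right (min_le_left _ _) _)
    have hσε : σ ≤ t + ε / 2 :=
      (min_le_right _ _).trans (add_le_add_right (min_le_right _ _) _)
    have hnear' : ∀ x ∈ Icc t σ, ‖history r u' x - history r u' t‖ < ρ ∧
        ‖history r v' x - history r u' t‖ < ρ := fun x hx => hball (by
      rw [Real.dist_eq, abs_of_nonneg (sub_nonneg.2 hx.1)]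
      linarith [hx.2])
    have h1 := (hu'.restart hT ht.1 ht.2.le).mono hστ
    have h2 := (hv'.restart hT ht.1 ht.2.le).mono hστ
    have hest := h1.norm_sub_le (ε := 0) (β := 0) (φ₀ := history r u' t) (δ := ρ) h2 htσ.le hK1
      (fun x hx => hKσ x ⟨hx.1, by linarith [hx.2]⟩) hL
      (fun x hx hxσ => hLδ t x ht.1 (by linarith) hx (by linarith)) (by linarith)
      (le_trans (by gcongr; linarith) hKL) (by rw [hhist, sub_self, norm_zero])
      (fun x hx => (hnear' x hx).1.le)
      (fun x hx => by linarith [(hnear' x hx).2])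
      (fun x hx χ hχ => by
        rw [sub_eq_zero.1 (norm_le_zero_iff.1 hχ), sub_self, norm_zero])
    refine ⟨σ, fun x hx => ?_, htσ, hσy⟩
    have hmem : max (σ - x) a ∈ Icc a σ :=
      ⟨le_max_right _ _, max_le (by linarith) (ht.1.trans htσ.le)⟩
    rcases le_total (max (σ - x) a) t with h | h
    · exact hAiff t htA _ ⟨by linarith [hmem.1], h⟩
    · have := hest _ ⟨h, hmem.2⟩
      rw [mul_zero, add_zero, mul_zero] at this
      exact sub_eq_zero.1 (norm_le_zero_iff.1 this)
  exact hAiff τ (hsub ⟨haτ, le_rfl⟩)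

end Local

section Maximal

variable {X : Type*} [NormedAddCommGroup X] [NormedSpace ℝ X] [CompleteSpace X] {r : ℝ}
  {hr : 0 < r} {T : ℝ → X →L[ℝ] X} {B : ℝ → HistorySpace r X → X} {a : ℝ}

/-- The maximal solution lives up to the supremum of all times of existence. It does not reach this
time, since every mild solution on a closed interval can be extended. -/
theorem exists_isMaximalMildSolution (hr : 0 < r) (hT : IsC0Semigroup T) {ω : ℝ}
    (hω : ∀ t : ℝ, 0 ≤ t → ‖T t‖ ≤ Real.exp (ω * t)) (hB : Continuous (Function.uncurry B))
    (hLip : LipschitzForCommonPast a B) (φ : HistorySpace r X) :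
    ∃ (b : EReal) (u : ℝ → X), IsMaximalMildSolution hr T B a φ b u := by
  classical
  set S : Set ℝ := {τ | a ≤ τ ∧ ∃ u, IsMildSolutionOn hr T B a φ τ u} with hS
  have hchoose : ∀ τ : S, ∃ u, IsMildSolutionOn hr T B a φ τ u := fun τ => τ.2.2
  choose U hU using hchoose
  set u : ℝ → X := fun t => if h : ∃ τ : S, t ≤ τ then U h.choose t else 0 with hu
  set b : EReal := sSup ((fun τ : ℝ => (τ : EReal)) '' S) with hb
  have hagree : ∀ τ (v : ℝ → X), a ≤ τ → IsMildSolutionOn hr T B a φ τ v →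
      EqOn v u (Icc (a - r) τ) := by
    intro τ v haτ hv t ht
    have hex : ∃ τ : S, t ≤ τ := ⟨⟨τ, haτ, v, hv⟩, ht.2⟩
    have h1 := hU hex.choose
    have h2 := hex.choose_spec
    simp only [hu, dif_pos hex]
    exact (hv.mono (min_le_left τ hex.choose)).eqOn hT hω hB hLip
      (le_min haτ hex.choose.2.1) (h1.mono (min_le_right _ _)) ⟨ht.1, le_min ht.2 h2⟩
  have hlt : ∀ τ (v : ℝ → X), a ≤ τ → IsMildSolutionOn hr T B a φ τ v → (τ : EReal) < b := by
    intro τ v haτ hv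
    obtain ⟨τ', hττ', w, hw⟩ := hv.exists_extension hT hω hB hLip haτ
    exact (EReal.coe_lt_coe_iff.2 hττ').trans_le
      (le_sSup ⟨τ', ⟨haτ.trans hττ'.le, w, hw⟩, rfl⟩)
  refine ⟨b, u, hlt a _ le_rfl (isMildSolutionOn_self hr hT φ), fun τ haτ hτ => ?_,
    fun τ v haτ hv => ⟨hlt τ v haτ hv, hagree τ v haτ hv⟩⟩
  obtain ⟨_, ⟨τ', ⟨haτ', v, hv⟩, rfl⟩, hττ'⟩ := lt_sSup_iff.1 hτ
  have hv' := hv.mono (EReal.coe_lt_coe_iff.1 hττ').le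
  exact hv'.congr haτ (hagree τ v haτ hv')

/-- The solutions `uₙ` are eventually defined up to time `t` and converge to `u` uniformly on
`[a - r, t]`. -/
def ConvergesUpTo (r a : ℝ) (bn : ℕ → EReal) (un : ℕ → ℝ → X) (u : ℝ → X) (t : ℝ) : Prop :=
  ∀ ε > 0, ∀ᶠ n in atTop, (t : EReal) < bn n ∧ ∀ x ∈ Icc (a - r) t, ‖un n x - u x‖ ≤ ε

omit [NormedSpace ℝ X] [CompleteSpace X] in
theorem ConvergesUpTo.mono {bn : ℕ → EReal} {un : ℕ → ℝ → X} {u : ℝ → X} {s t : ℝ}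
    (h : ConvergesUpTo r a bn un u t) (hst : s ≤ t) : ConvergesUpTo r a bn un u s :=
  fun ε hε => (h ε hε).mono fun _ hn =>
    ⟨(EReal.coe_le_coe_iff.2 hst).trans_lt hn.1, fun x hx => hn.2 x ⟨hx.1, hx.2.trans hst⟩⟩

/-- A local solution that continues `u` from time `s` is part of `u`, by maximality. -/
theorem IsMaximalMildSolution.lt_of_local (hT : IsC0Semigroup T) {ω : ℝ}
    (hω : ∀ t : ℝ, 0 ≤ t → ‖T t‖ ≤ Real.exp (ω * t)) (hB : Continuous (Function.uncurry B))
    {φ φ₀ : HistorySpace r X} {b : EReal} {u : ℝ → X} (hu : IsMaximalMildSolution hr T B a φ b u)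
    {s τ ρ : ℝ} (has : a ≤ s) (hsτ : s ≤ τ) (hsb : (s : EReal) < b)
    (hex : ∃ v, IsMildSolutionOn hr T B s (history r u s) τ v ∧
      ∀ t ∈ Icc s τ, ‖history r v t - φ₀‖ ≤ ρ) :
    (τ : EReal) < b ∧ ∀ t ∈ Icc s τ, ‖history r u t - φ₀‖ ≤ ρ := by
  obtain ⟨v, hv, hvρ⟩ := hex
  obtain ⟨w, hw, -, hwv⟩ := (hu.isMildSolutionOn s has hsb).concat hT hω hB has hv hsτ
  obtain ⟨hτb, hwu⟩ := hu.unique τ w (has.trans hsτ) hw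
  refine ⟨hτb, fun t ht => ?_⟩
  have h : history r u t = history r v t := history_congr fun x hx => by
    rw [← hwu ⟨by linarith [hx.1, ht.1], hx.2.trans ht.2⟩,
      hwv ⟨by linarith [hx.1, ht.1], hx.2.trans ht.2⟩]
  rw [h]
  exact hvρ t ht

omit [NormedSpace ℝ X] [CompleteSpace X] in
/-- `B` is uniformly continuous at the compact trajectory `{(t, u_t)}`. -/
theorem exists_uniform_modulus (hB : Continuous (Function.uncurry B)) {u : ℝ → X} {s τ : ℝ}
    (hu : ContinuousOn u (Icc (s - r) τ)) {β : ℝ} (hβ : 0 < β) :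
    ∃ d > 0, ∀ t ∈ Icc s τ, ∀ χ : HistorySpace r X, ‖χ - history r u t‖ ≤ d →
      ‖B t χ - B t (history r u t)‖ ≤ β := by
  have hcomp : IsCompact ((fun t => (t, history r u t)) '' Icc s τ) :=
    isCompact_Icc.image_of_continuousOn (continuousOn_id.prodMk (continuousOn_history hu))
  have h := hcomp.uniformContinuousAt_of_continuousAt (Function.uncurry B)
    (fun x _ => hB.continuousAt) (Metric.dist_mem_uniformity hβ)
  obtain ⟨d, hd, hd'⟩ := Metric.mem_uniformity_dist.1 h
  refine ⟨d / 2, by positivity, fun t ht χ hχ => ?_⟩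
  have h1 := @hd' (t, history r u t) (t, χ) (by
    rw [Prod.dist_eq, dist_self, max_lt_iff, dist_comm, dist_eq_norm]
    exact ⟨hd, by linarith⟩) (mem_image_of_mem _ ht)
  rw [← dist_eq_norm, dist_comm]
  exact (show dist (B t (history r u t)) (B t χ) < β from h1).le

/-- Convergence extends beyond `t₀` from any slightly earlier time `s`. As the length `δ` does not
depend on `s`, this applies when `t₀` is a supremum of times up to which convergence is known. -/
theorem IsMaximalMildSolution.convergesUpTo_extend (hT : IsC0Semigroup T) {ω : ℝ}
    (hω : ∀ t : ℝ, 0 ≤ t → ‖T t‖ ≤ Real.exp (ω * t)) (hB : Continuous (Function.uncurry B))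
    (hLip : LipschitzForCommonPast a B) {φ : HistorySpace r X} {b : EReal} {u : ℝ → X}
    {φn : ℕ → HistorySpace r X} {bn : ℕ → EReal} {un : ℕ → ℝ → X}
    (hu : IsMaximalMildSolution hr T B a φ b u)
    (hun : ∀ n, IsMaximalMildSolution hr T B a (φn n) (bn n) (un n))
    {t₀ : ℝ} (ht₀ : a ≤ t₀) (ht₀b : (t₀ : EReal) < b) :
    ∃ δ > 0, ∀ s, a ≤ s → t₀ - δ ≤ s → s ≤ t₀ → ConvergesUpTo r a bn un u s →
      ConvergesUpTo r a bn un u (t₀ + δ) := by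
  obtain ⟨δ, hδ, ρ, hρ, L, hL, K, hK1, hLδ, hKσ, hKL, hδ1, hex⟩ :=
    exists_uniform_local_isMildSolutionOn hr hT hω hB hLip ht₀ (history r u t₀)
  have hut₀ := hu.isMildSolutionOn t₀ ht₀ ht₀b
  have hcont : ContinuousOn (history r u) (Icc a t₀) := continuousOn_history hut₀.continuousOn
  obtain ⟨ε₀, hε₀, hhist⟩ := Metric.continuousWithinAt_iff.1 (hcont t₀ ⟨ht₀, le_rfl⟩) (δ / 2)
    (by positivity)
  set δ' := min δ (ε₀ / 2) with hδ'
  have hδ'δ : δ' ≤ δ := min_le_left _ _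
  refine ⟨δ', by positivity, fun s has hs hst₀ hconv => ?_⟩
  refine ConvergesUpTo.mono (t := t₀ + δ) ?_ (by linarith)
  have hsτ : s ≤ t₀ + δ := by linarith
  have hsb : (s : EReal) < b := (EReal.coe_le_coe_iff.2 hst₀).trans_lt ht₀b
  have hus : ‖history r u s - history r u t₀‖ ≤ δ / 2 := by
    rw [← dist_eq_norm]
    refine (hhist ⟨has, hst₀⟩ ?_).le
    rw [Real.dist_eq, abs_sub_comm, abs_of_nonneg (sub_nonneg.2 hst₀)]
    have : δ' ≤ ε₀ / 2 := min_le_right _ _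
    linarith
  obtain ⟨hτb, huρ⟩ := hu.lt_of_local hT hω hB has hsτ hsb
    (hex s has (by linarith) hst₀ _ (by linarith))
  have huτ := hu.isMildSolutionOn (t₀ + δ) (has.trans hsτ) hτb
  intro ε hε
  have hK0 : 0 < K := one_pos.trans_le hK1
  obtain ⟨d, hd, hmod⟩ := exists_uniform_modulus hB (s := s) (β := ε / (4 * K))
    (huτ.continuousOn.mono (Icc_subset_Icc_left (by linarith))) (by positivity)
  set ε' := min (min (ε / (8 * K)) d) (min (ρ / 2) (δ / 2)) with hε'
  have hε'0 : 0 < ε' := by positivity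
  have he1 : ε' ≤ ε / (8 * K) := (min_le_left _ _).trans (min_le_left _ _)
  have he2 : ε' ≤ d := (min_le_left _ _).trans (min_le_right _ _)
  have he3 : ε' ≤ ρ / 2 := (min_le_right _ _).trans (min_le_left _ _)
  have he4 : ε' ≤ δ / 2 := (min_le_right _ _).trans (min_le_right _ _)
  filter_upwards [hconv ε' hε'0] with n hn
  have huns := (hun n).isMildSolutionOn s has hn.1
  have hpast : ‖history r (un n) s - history r u s‖ ≤ ε' :=
    norm_history_sub_history_le (huns.continuousOn_window ⟨has, le_rfl⟩)
      (hut₀.continuousOn_window ⟨has, hst₀⟩) hε'0.le fun x hx =>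
        hn.2 x ⟨by linarith [hx.1], hx.2⟩
  obtain ⟨hτbn, hunρ⟩ := (hun n).lt_of_local hT hω hB has hsτ hn.1
    (hex s has (by linarith) hst₀ _ (by
      have := norm_sub_le_norm_sub_add_norm_sub (history r (un n) s) (history r u s)
        (history r u t₀)
      linarith))
  have hunτ := (hun n).isMildSolutionOn (t₀ + δ) (has.trans hsτ) hτbn
  refine ⟨hτbn, fun x hx => ?_⟩
  rcases le_total x s with hxs | hxs
  · refine (hn.2 x ⟨hx.1, hxs⟩).trans (he1.trans ?_)
    rw [div_le_iff₀ (by positivity)]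
    nlinarith
  · have hτs : t₀ + δ - s ≤ 2 * δ := by linarith
    have hest := (hunτ.restart hT has hsτ).norm_sub_le (ε := ε') (β := ε / (4 * K)) (δ := ρ)
      (φ₀ := history r u t₀) (huτ.restart hT has hsτ) hsτ hK1
      (fun σ hσ => hKσ σ ⟨hσ.1, hσ.2.trans hτs⟩) hL
      (fun t hst ht => hLδ s t has (by linarith) hst ht) (by linarith)
      (le_trans (by gcongr) hKL) hpast (fun t ht => by linarith [hunρ t ht])
      (fun t ht => by linarith [huρ t ht]) (fun t ht χ hχ => hmod t ht χ (hχ.trans he2))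
    refine (hest x ⟨hxs, hx.2⟩).trans ?_
    calc 2 * K * (2 * ε' + ε / (4 * K)) ≤ 2 * K * (2 * (ε / (8 * K)) + ε / (4 * K)) := by gcongr
      _ = ε := by field_simp; ring

theorem IsMaximalMildSolution.convergesUpTo (hT : IsC0Semigroup T) {ω : ℝ}
    (hω : ∀ t : ℝ, 0 ≤ t → ‖T t‖ ≤ Real.exp (ω * t)) (hB : Continuous (Function.uncurry B))
    (hLip : LipschitzForCommonPast a B) {φ : HistorySpace r X} {b : EReal} {u : ℝ → X}
    {φn : ℕ → HistorySpace r X} {bn : ℕ → EReal} {un : ℕ → ℝ → X}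
    (hu : IsMaximalMildSolution hr T B a φ b u)
    (hun : ∀ n, IsMaximalMildSolution hr T B a (φn n) (bn n) (un n))
    (hφ : Tendsto (fun n => ‖φn n - φ‖) atTop (𝓝 0)) {τ : ℝ} (haτ : a ≤ τ)
    (hτb : (τ : EReal) < b) : ConvergesUpTo r a bn un u τ := by
  have hbase : ConvergesUpTo r a bn un u a := fun ε hε => by
    filter_upwards [hφ.eventually_lt_const hε] with n hn
    refine ⟨(hun n).lt, fun x hx => ?_⟩
    have e1 := ((hun n).isMildSolutionOn a le_rfl (hun n).lt).initial
      ⟨x - a, by linarith [hx.1], by linarith [hx.2]⟩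
    have e2 := (hu.isMildSolutionOn a le_rfl hu.lt).initial
      ⟨x - a, by linarith [hx.1], by linarith [hx.2]⟩
    simp only [add_sub_cancel] at e1 e2
    rw [e1, e2]
    exact ((φn n - φ).norm_coe_le_norm _).trans hn.le
  set S : Set ℝ := {t | t ∈ Icc a τ ∧ ConvergesUpTo r a bn un u t} with hS
  have haS : a ∈ S := ⟨⟨le_rfl, haτ⟩, hbase⟩
  have hbdd : BddAbove S := ⟨τ, fun t ht => ht.1.2⟩
  have h1 : a ≤ sSup S := le_csSup hbdd haS
  have h2 : sSup S ≤ τ := csSup_le ⟨a, haS⟩ fun t ht => ht.1.2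
  obtain ⟨δ, hδ, hext⟩ := hu.convergesUpTo_extend hT hω hB hLip hun h1
    ((EReal.coe_le_coe_iff.2 h2).trans_lt hτb)
  obtain ⟨s, hsS, hs⟩ := exists_lt_of_lt_csSup ⟨a, haS⟩ (sub_lt_self (sSup S) hδ)
  have h3 := hext s hsS.1.1 hs.le (le_csSup hbdd hsS) hsS.2
  rcases le_total (sSup S + δ) τ with h | h
  · have : sSup S + δ ≤ sSup S := le_csSup hbdd ⟨⟨by linarith, h⟩, h3⟩
    linarith
  · exact h3.mono h

omit [CompleteSpace X] in
theorem IsMildSolutionOn.congr_term {B' : ℝ → HistorySpace r X → X}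
    (hBB' : ∀ t, a ≤ t → ∀ ψ, B t ψ = B' t ψ) {φ : HistorySpace r X} {τ : ℝ} {u : ℝ → X}
    (h : IsMildSolutionOn hr T B a φ τ u) : IsMildSolutionOn hr T B' a φ τ u := by
  have hEq : ∀ t ∈ Icc a τ, EqOn (fun σ => T (t - σ) (B σ (history r u σ)))
      (fun σ => T (t - σ) (B' σ (history r u σ))) (uIcc a t) := fun t ht σ hσ => by
    rw [uIcc_of_le ht.1] at hσ
    simp only [hBB' σ hσ.1]
  exact ⟨h.continuousOn, h.initial,
    fun t ht => (h.integrable t ht).congr fun σ hσ => hEq t ht (uIoc_subset_uIcc hσ),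
    fun t ht => by rw [h.eq_integral t ht, intervalIntegral.integral_congr (hEq t ht)]⟩

omit [CompleteSpace X] in
theorem IsMaximalMildSolution.congr_term {B' : ℝ → HistorySpace r X → X}
    (hBB' : ∀ t, a ≤ t → ∀ ψ, B t ψ = B' t ψ) {φ : HistorySpace r X} {b : EReal} {u : ℝ → X}
    (h : IsMaximalMildSolution hr T B a φ b u) : IsMaximalMildSolution hr T B' a φ b u :=
  ⟨h.lt, fun τ haτ hτ => (h.isMildSolutionOn τ haτ hτ).congr_term hBB',
    fun τ v haτ hv => h.unique τ v haτ (hv.congr_term fun t ht ψ => (hBB' t ht ψ).symm)⟩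

end Maximal

/-! ### Well-posedness of the equation with state-dependent delays -/

theorem theorem4 {X : Type*} [NormedAddCommGroup X] [NormedSpace ℝ X] [CompleteSpace X]
    {r : ℝ} (hr : 0 < r) (a : ℝ)
    -- the semigroup `T(t) = e^{-At}`
    (T : ℝ → X →L[ℝ] X) (hT : IsC0Semigroup T)
    (ω : ℝ) (hω : ∀ t : ℝ, 0 ≤ t → ‖T t‖ ≤ Real.exp (ω * t))
    -- the function `g` generating the delays
    (g gd gc : Icc (-r) (0 : ℝ) → ℝ → HistorySpace r X → ℝ)
    (η h : ℕ → ℝ → HistorySpace r X → ℝ)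
    (hg : HasUniformlyBoundedVariation g)
    (hsplit : IsSplitting g gd gc)
    (hgc : IsPointwiseContinuous gc)
    (hgd : HasContinuousJumps gd η h)
    (hgcLip : IsLipschitzInVariation a gc)
    (hign : IgnoresRecentHistory a η h)
    -- the nonlinearities `p` and `G`
    (p : ℝ → X → X)
    (hpLip : ∃ Lp : ℝ, ∀ (t s : ℝ) (u v : X), ‖p t u - p s v‖ ≤ Lp * (|s - t| + ‖u - v‖))
    (hpGrowth : ∃ C₁ C₂ : ℝ, 0 ≤ C₁ ∧ 0 ≤ C₂ ∧ ∀ (s : ℝ) (u : X), ‖p s u‖ ≤ C₁ * ‖u‖ + C₂)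
    (G : ℝ → X → X → X)
    (hGcont : Continuous (fun x : ℝ × X × X => G x.1 x.2.1 x.2.2))
    (hGLip : ∀ R : ℝ, 0 < R → ∃ L : ℝ, 0 < L ∧ ∀ t : ℝ, a < t → ∀ u₁ u₂ v₁ v₂ : X,
      ‖u₁‖ ≤ R → ‖u₂‖ ≤ R → ‖v₁‖ ≤ R → ‖v₂‖ ≤ R →
        ‖G t u₁ v₁ - G t u₂ v₂‖ ≤ L * (‖u₁ - u₂‖ + ‖v₁ - v₂‖)) :
    -- existence and uniqueness on a maximal interval `[a, b)`
    (∀ φ : HistorySpace r X, ∃ (b : EReal) (u : ℝ → X),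
      IsMaximalMildSolution hr T (delayTerm hr G p g) a φ b u) ∧
    -- continuous dependence on the initial data
    (∀ (φ : HistorySpace r X) (b : EReal) (u : ℝ → X)
      (φn : ℕ → HistorySpace r X) (bn : ℕ → EReal) (un : ℕ → ℝ → X),
      IsMaximalMildSolution hr T (delayTerm hr G p g) a φ b u →
      (∀ n, IsMaximalMildSolution hr T (delayTerm hr G p g) a (φn n) (bn n) (un n)) →
      Tendsto (fun n => ‖φn n - φ‖) atTop (𝓝 0) →
      ∀ t : ℝ, a ≤ t → (t : EReal) < b →
        (∀ᶠ n in atTop, (t : EReal) < bn n) ∧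
        Tendsto (fun n => ‖history r (un n) t - history r u t‖) atTop (𝓝 0)) := by
  obtain ⟨Lp', hp'⟩ := hpLip
  obtain ⟨C₁, C₂, hC₁, hC₂, hpG⟩ := hpGrowth
  obtain ⟨L, hL, hgcL⟩ := hgcLip
  -- If `X` is trivial, the given constant may be negative.
  set Lp := |Lp'| with hLp_def
  have hLp : 0 ≤ Lp := abs_nonneg _
  have hp : ∀ (t s : ℝ) (u v : X), ‖p t u - p s v‖ ≤ Lp * (|s - t| + ‖u - v‖) :=
    fun t s u v => (hp' t s u v).trans (by gcongr; exact le_abs_self _)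
  have hpc : Continuous (Function.uncurry p) := by
    refine continuous_iff_continuousAt.2 fun x₀ => tendsto_iff_norm_sub_tendsto_zero.2 ?_
    refine squeeze_zero (fun _ => norm_nonneg _) (fun x => hp x.1 x₀.1 x.2 x₀.2) ?_
    have hcont : Continuous fun x : ℝ × X => Lp * (|x₀.1 - x.1| + ‖x.2 - x₀.2‖) := by fun_prop
    simpa using hcont.tendsto x₀
  have hpt : ∀ t, Continuous (p t) := fun t => hpc.comp (Continuous.prodMk_right t)
  have hgcBV : BoundedVariationOn (fun θ => gc θ a 0) univ := hsplit.boundedVariationOn hg a 0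
  set V := (eVariationOn (fun θ => gc θ a 0) univ).toReal with hV_def
  have hV : 0 ≤ V := ENNReal.toReal_nonneg
  have hgcV : eVariationOn (fun θ => gc θ a 0) univ ≤ ENNReal.ofReal V :=
    (ENNReal.ofReal_toReal hgcBV).ge
  -- Mild solutions involve `t ≥ a` only; freezing `t` below `a` makes `B` continuous everywhere.
  set B : ℝ → HistorySpace r X → X := fun t ψ => delayTerm hr G p g (max t a) ψ with hB_def
  have hBB : ∀ t, a ≤ t → ∀ ψ, delayTerm hr G p g t ψ = B t ψ := fun t ht ψ => by
    simp only [hB_def, max_eq_left ht]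
  have hB : Continuous (Function.uncurry B) := by
    have hF := continuous_delayFunctional hg hsplit hgd hL hV hgcL hgcV hLp hC₁ hC₂ hp hpG hpc
    exact hGcont.comp ((continuous_fst.max continuous_const).prodMk
      (((continuous_eval_const (zeroPt hr)).comp continuous_snd).prodMk hF))
  have hBLip : LipschitzForCommonPast a B := by
    intro t₀ ht₀ φ₀
    obtain ⟨δ, hδ, K, hK, h⟩ := lipschitzForCommonPast_delayTerm hr hg hsplit hgd hign hL hV hgcL
      hgcV hLp hC₁ hC₂ hp hpG hpc hGLip t₀ ht₀ φ₀
    refine ⟨δ, hδ, K, hK, fun s t has hs hst ht φ ψ hφ hψ hag => ?_⟩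
    rw [← hBB t (has.trans hst.le), ← hBB t (has.trans hst.le)]
    exact h s t has hs hst ht φ ψ hφ hψ hag
  refine ⟨fun φ => ?_, fun φ b u φn bn un hu hun hφ t hat htb => ?_⟩
  · obtain ⟨b, u, hu⟩ := exists_isMaximalMildSolution hr hT hω hB hBLip φ
    exact ⟨b, u, hu.congr_term fun t ht ψ => (hBB t ht ψ).symm⟩
  · have hconv := (hu.congr_term hBB).convergesUpTo hT hω hB hBLip
      (fun n => (hun n).congr_term hBB) hφ hat htb
    refine ⟨(hconv 1 one_pos).mono fun n hn => hn.1, Metric.tendsto_nhds.2 fun ε hε => ?_⟩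
    filter_upwards [hconv (ε / 2) (by positivity)] with n hn
    rw [Real.dist_eq, sub_zero, abs_of_nonneg (norm_nonneg _)]
    refine (norm_history_sub_history_le
      (((hun n).isMildSolutionOn t hat hn.1).continuousOn_window ⟨hat, le_rfl⟩)
      ((hu.isMildSolutionOn t hat htb).continuousOn_window ⟨hat, le_rfl⟩) (by positivity)
      fun x hx => hn.2 x ⟨by linarith [hx.1], hx.2⟩).trans_lt (by linarith)
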